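/- Let $d\in\mathbb N$, $\gamma\in(0,1)$, $T>0$. Let $\mathscr F_d$ be the set of (non-planar) rooted forests with vertices decorated by $\{1,\dots,d\}$, with empty forest $\mathbf 1$, commutative forest product $\odot$ (disjoint union), number of vertices $|\zeta|$, and grafting $\lfloor\zeta\rfloor_i$ of a forest $\zeta$ onto a new root decorated by $i$. Let $H=\langle\mathscr F_d\rangle$ be the real vector space with basis $\mathscr F_d$, with the bilinear product $\odot$, the linear map $\varepsilon(\zeta)=\delta_{\mathbf 1,\zeta}$, and the Connes–Kreimer coproduct, i.e. the algebra homomorphism $\Delta_\star:H\to H\otimes H$ with $\Delta_\star\mathbf 1=\mathbf 1\otimes\mathbf 1$ and $\Delta_\star\lfloor\zeta\rfloor_i=\lfloor\zeta\rfloor_i\otimes\mathbf 1+(\mathrm{id}\otimes\lfloor\cdot\rfloor_i)\Delta_\star\zeta$. **Branched rough paths.** $\hat{\mathscr R}^\gamma([0,T],\mathbb R^d)$ is the set of maps $\hat X:[0,T]^2\to H^*$ into the algebraic dual such that for all $s,u,t\in[0,T]$ and all forests $\zeta,\zeta_1,\zeta_2$: 1. $\hat X_{st}(\mathbf 1)=1$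 and $\hat X_{st}(\zeta_1\odot\zeta_2)=\hat X_{st}(\zeta_1)\hat X_{st}(\zeta_2)$; 2. $\hat X_{tt}=\varepsilon$ and $\hat X_{st}(\zeta)=(\hat X_{su}\otimes\hat X_{ut})\Delta_\star\zeta$; 3. $\sup_{s\ne t}|\hat X_{st}(\zeta)|\,/\,|t-s|^{\gamma|\zeta|}<\infty$. **Models.** The Connes–Kreimer regularity structure has index set $\gamma\mathbb N_0$, model space $H=\bigoplus_{k}H_k$ (algebraic direct sum) with $H_k=\mathrm{span}\{\zeta:|\zeta|=k\}$ in homogeneity $k\gamma$, and structure group $G=\{(g\otimes\mathrm{id})\Delta_\star: g:H\to\mathbb R\text{ a unital algebra homomorphism}\}$. Let $\|\cdot\|$ be the Euclidean norm on $H$ for which $\mathscr F_d$ is orthonormal, and $\|x\|_m$ the norm of the component of $x$ in $H_m$. A model on $\mathbb R$ is a pair $(\Pi,\Gamma)$, where $\Pi_s:H\to\mathscr S'(\mathbb R)$ is linear for every $s\in\mathbb R$ and $\Gamma:\mathbb R^2\to G$, such that for all $s,u,t\in\mathbb R$ $$\Gamma_{ss}=\mathrm{id},\qquad \Gamma_{su}\Gamma_{ut}=\Gamma_{st},\qquad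 \Pi_s\Gamma_{st}=\Pi_t,$$ and such that for every compact $K\subset\mathbb R$ and $k\in\mathbb N_0$ there is a constant $C$ with $$\|\Gamma_{st}a\|_m\le C\|a\|\,|s-t|^{\gamma(k-m)},\qquad |(\Pi_s a)(\mathfrak S^\delta_s u)|\le C\|a\|\,\delta^{\gamma k}$$ for all $s,t\in K$, $a\in H_k$, integers $0\le m<k$, $\delta\in(0,1]$ and all smooth real $u$ with compact support in $(-1,1)$, $\|u\|_\infty\le1$ and $\|u'\|_\infty\le 1$; here $(\mathfrak S_s^\delta u)(y)=\delta^{-1}u(\delta^{-1}(y-s))$. Let $\mathscr M_1^{\mathrm f}([0,T])$ be the set of those models for which $\Pi_s\mathbf 1$ is the constant function $1$ for all $s\in\mathbb R$, and $\Gamma_{st}=\mathrm{id}$ whenever $s,t\in(-\infty,0]$ or $s,t\in[T,\infty)$. **Theorem.** There is a bijection $I:\hat{\mathscr R}^\gamma([0,T],\mathbb R^d)\to\mathscr M_1^{\mathrm f}([0,T])$ that maps each $\hat X$ to the unique $(\Pi,\Gamma)\in\mathscr M_1^{\mathrm f}([0,T])$ such that for all $s\in[0,T]$ and $x\in H$ the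 distribution $\Pi_s x$ is given by a continuous function on $\mathbb R$, and $$(\Pi_s x)(t)=\hat X_{st}(x),\qquad \Gamma_{st}x=(\hat X_{ts}\otimes\mathrm{id})\Delta_\star x\qquad\text{for all } s,t\in[0,T],\ x\in H.$$ -/

import Mathlib

open scoped TensorProduct SchwartzMap

noncomputable section

namespace ConnesKreimer

/-! ### Decorated rooted forests -/

/-- Planar rooted forests with vertices decorated by `I`.  The forest `cons i a r` consists of a
first tree, whose root has decoration `i` and whose root is joined to the trees of `a`, followed by
the trees of `r`. -/
inductive PlanarForest (I : Type) : Type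
  | empty : PlanarForest I
  | cons (root : I) (children rest : PlanarForest I) : PlanarForest I

namespace PlanarForest

variable {I : Type}

/-- Number of vertices. -/
def size : PlanarForest I → ℕ
  | empty => 0
  | cons _ a r => (a.size + 1) + r.size

/-- Juxtaposition of planar forests. -/
def append : PlanarForest I → PlanarForest I → PlanarForest I
  | empty, q => q
  | cons i a r, q => cons i a (append r q)

/-- Two planar forests are the same nonplanar forest if one is obtained from the other by permuting
trees, at every level. -/
inductive Reorder : PlanarForest I → PlanarForest I → Prop
  | refl (p : PlanarForest I) : Reorder p p
  | symm {p q : PlanarForest I} : Reorder p q → Reorder q p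
  | trans {p q r : PlanarForest I} : Reorder p q → Reorder q r → Reorder p r
  | cons (i : I) {a a' r r' : PlanarForest I} :
      Reorder a a' → Reorder r r' → Reorder (.cons i a r) (.cons i a' r')
  | swap (i j : I) (a b r : PlanarForest I) :
      Reorder (.cons i a (.cons j b r)) (.cons j b (.cons i a r))

/-- Planar forests up to reordering. -/
def setoid (I : Type) : Setoid (PlanarForest I) :=
  ⟨Reorder, Reorder.refl, Reorder.symm, Reorder.trans⟩

theorem Reorder.size_eq {p q : PlanarForest I} (h : Reorder p q) : p.size = q.size := by
  induction h with
  | refl p => rfl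
  | symm _ ih => exact ih.symm
  | trans _ _ ih₁ ih₂ => exact ih₁.trans ih₂
  | cons i _ _ ih₁ ih₂ => simp only [size, ih₁, ih₂]
  | swap i j a b r => simp only [size]; omega

theorem append_empty (p : PlanarForest I) : p.append .empty = p := by
  induction p with
  | empty => rfl
  | cons i a r _ ih => simp only [append, ih]

theorem append_assoc (p q r : PlanarForest I) :
    (p.append q).append r = p.append (q.append r) := by
  induction p with
  | empty => rfl
  | cons i a s _ ih => simp only [append, ih]

theorem Reorder.append_left {p p' : PlanarForest I} (h : Reorder p p') (q : PlanarForest I) :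
    Reorder (p.append q) (p'.append q) := by
  induction h with
  | refl p => exact .refl _
  | symm _ ih => exact ih.symm
  | trans _ _ ih₁ ih₂ => exact ih₁.trans ih₂
  | cons i h₁ _ _ ih₂ => exact .cons i h₁ ih₂
  | swap i j a b r => exact .swap i j a b _

theorem Reorder.append_right (p : PlanarForest I) {q q' : PlanarForest I} (h : Reorder q q') :
    Reorder (p.append q) (p.append q') := by
  induction p with
  | empty => exact h
  | cons i a r _ ih => exact .cons i (.refl a) ih

theorem reorder_append_cons (i : I) (a p q : PlanarForest I) :
    Reorder (.cons i a (p.append q)) (p.append (.cons i a q)) := by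
  induction p with
  | empty => exact .refl _
  | cons j b r _ ih => exact (Reorder.swap i j a b _).trans (.cons j (.refl b) ih)

theorem reorder_append_comm (p q : PlanarForest I) : Reorder (p.append q) (q.append p) := by
  induction p with
  | empty => rw [append_empty]; exact .refl _
  | cons i a r _ ih => exact (Reorder.cons i (.refl a) ih).trans (reorder_append_cons i a q r)

end PlanarForest

/-- The set of (nonplanar) rooted forests with vertices decorated by `I`. -/
def Forest (I : Type) : Type := Quotient (PlanarForest.setoid I)

namespace Forest

variable {I : Type}

/-- The forests form a commutative monoid under the forest product `⊙` (disjoint union), the unit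
being the empty forest. -/
instance : CommMonoid (Forest I) where
  mul := Quotient.map₂ PlanarForest.append fun _ p' hp q _ hq =>
    (PlanarForest.Reorder.append_left hp q).trans (PlanarForest.Reorder.append_right p' hq)
  one := Quotient.mk (PlanarForest.setoid I) .empty
  mul_assoc := by
    rintro ⟨p⟩ ⟨q⟩ ⟨r⟩
    exact congrArg (Quotient.mk (PlanarForest.setoid I)) (PlanarForest.append_assoc p q r)
  one_mul := by
    rintro ⟨p⟩
    rfl
  mul_one := by
    rintro ⟨p⟩
    exact congrArg (Quotient.mk (PlanarForest.setoid I)) (PlanarForest.append_empty p)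
  mul_comm := by
    rintro ⟨p⟩ ⟨q⟩
    exact Quotient.sound (s := PlanarForest.setoid I) (PlanarForest.reorder_append_comm p q)

/-- `⌊ζ⌋ᵢ`: the tree obtained by joining the trees of `ζ` to a new root with decoration `i`. -/
def graft (i : I) : Forest I → Forest I :=
  Quotient.map (fun p => .cons i p .empty) fun _ _ h => .cons i h (.refl _)

/-- `|ζ|`: the number of vertices of `ζ`. -/
def size : Forest I → ℕ :=
  Quotient.lift PlanarForest.size fun _ _ h => PlanarForest.Reorder.size_eq h

end Forest

/-! ### The Connes–Kreimer Hopf algebra -/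

/-- The real vector space `⟨𝓕_d⟩` with basis the forests decorated by `{1, …, d}`, with the
commutative algebra structure given by the bilinear extension of the forest product. -/
abbrev ForestSpace (d : ℕ) : Type := MonoidAlgebra ℝ (Forest (Fin d))

variable {d : ℕ}

/-- The basis vector of the forest space belonging to a forest. -/
abbrev basisForest (ζ : Forest (Fin d)) : ForestSpace d := MonoidAlgebra.single ζ 1

/-- The linear extension of `⌊·⌋ᵢ`. -/
def graftLin (i : Fin d) : ForestSpace d →ₗ[ℝ] ForestSpace d :=
  MonoidAlgebra.mapDomainLinearMap ℝ ℝ (Forest.graft i)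

/-- The recursion of the coproduct `Δ_⋆`, on planar representatives. -/
def coproductPlanar : PlanarForest (Fin d) → ForestSpace d ⊗[ℝ] ForestSpace d
  | .empty => 1
  | .cons i a r =>
      (basisForest (Forest.graft i (Quotient.mk (PlanarForest.setoid _) a)) ⊗ₜ[ℝ] 1
        + LinearMap.lTensor (ForestSpace d) (graftLin i) (coproductPlanar a))
      * coproductPlanar r

theorem coproductPlanar_reorder {p q : PlanarForest (Fin d)} (h : PlanarForest.Reorder p q) :
    coproductPlanar p = coproductPlanar q := by
  induction h with
  | refl p => rfl
  | symm _ ih => exact ih.symm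
  | trans _ _ ih₁ ih₂ => exact ih₁.trans ih₂
  | @cons i a a' r r' h₁ _ ih₁ ih₂ =>
    have ha : Quotient.mk (PlanarForest.setoid (Fin d)) a = Quotient.mk _ a' := Quotient.sound h₁
    simp only [coproductPlanar, ih₁, ih₂, ha]
  | swap i j a b r =>
    simp only [coproductPlanar]
    exact mul_left_comm _ _ _

theorem coproductPlanar_append (p q : PlanarForest (Fin d)) :
    coproductPlanar (p.append q) = coproductPlanar p * coproductPlanar q := by
  induction p with
  | empty => exact (one_mul _).symm
  | cons i a r _ ih => simp only [PlanarForest.append, coproductPlanar, ih, mul_assoc]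

/-- The Connes–Kreimer coproduct `Δ_⋆` on `⟨𝓕_d⟩`, as an algebra homomorphism. -/
def coproduct : ForestSpace d →ₐ[ℝ] ForestSpace d ⊗[ℝ] ForestSpace d :=
  MonoidAlgebra.lift ℝ _ (Forest (Fin d))
    { toFun := Quotient.lift coproductPlanar fun _ _ h => coproductPlanar_reorder h
      map_one' := rfl
      map_mul' := by
        rintro ⟨p⟩ ⟨q⟩
        exact coproductPlanar_append p q }

/-- Together with `map_one` and `map_mul`, this is the recursion that defines `Δ_⋆`:
`Δ_⋆ ⌊ζ⌋ᵢ = ⌊ζ⌋ᵢ ⊗ 1 + (id ⊗ ⌊·⌋ᵢ) Δ_⋆ ζ`. -/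
theorem coproduct_graft (i : Fin d) (ζ : Forest (Fin d)) :
    coproduct (basisForest (Forest.graft i ζ)) =
      basisForest (Forest.graft i ζ) ⊗ₜ[ℝ] 1
        + LinearMap.lTensor (ForestSpace d) (graftLin i) (coproduct (basisForest ζ)) := by
  obtain ⟨p⟩ := ζ
  have h (q : PlanarForest (Fin d)) :
      coproduct (basisForest (Quotient.mk (PlanarForest.setoid _) q)) = coproductPlanar q :=
    (MonoidAlgebra.lift_single _ _ _).trans (one_smul _ _)
  exact (h _).trans <| by
    rw [coproductPlanar, coproductPlanar, mul_one, ← h p]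
    rfl

/-- The counit `ε`, `ε(ζ) = δ_{1,ζ}`. -/
def counit : ForestSpace d →ₗ[ℝ] ℝ :=
  (Finsupp.lapply 1) ∘ₗ (MonoidAlgebra.coeffLinearEquiv ℝ).toLinearMap

/-- `(g ⊗ id) Δ_⋆` for a linear functional `g` on the forest space. -/
def leftAction (g : Module.Dual ℝ (ForestSpace d)) : ForestSpace d →ₗ[ℝ] ForestSpace d :=
  (TensorProduct.lid ℝ (ForestSpace d)).toLinearMap ∘ₗ
    LinearMap.rTensor (ForestSpace d) g ∘ₗ coproduct.toLinearMap

/-- The convolution `(g ⊗ h) Δ_⋆` of two linear functionals. -/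
def convolution (g h : Module.Dual ℝ (ForestSpace d)) : Module.Dual ℝ (ForestSpace d) :=
  (TensorProduct.lid ℝ ℝ).toLinearMap ∘ₗ TensorProduct.map g h ∘ₗ coproduct.toLinearMap

/-! ### Branched rough paths -/

/-- `X : [0,T]² → ⟨𝓕_d⟩*` is a `γ`-Hölder branched rough path. -/
structure IsBranchedRoughPath (γ T : ℝ)
    (X : Set.Icc (0 : ℝ) T → Set.Icc (0 : ℝ) T → Module.Dual ℝ (ForestSpace d)) : Prop where
  map_one : ∀ s t, X s t 1 = 1
  map_mul : ∀ s t, ∀ ζ₁ ζ₂ : Forest (Fin d),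
    X s t (basisForest ζ₁ * basisForest ζ₂) = X s t (basisForest ζ₁) * X s t (basisForest ζ₂)
  diag : ∀ t, X t t = counit
  chen : ∀ s u t, ∀ ζ : Forest (Fin d),
    X s t (basisForest ζ) = convolution (X s u) (X u t) (basisForest ζ)
  holder : ∀ ζ : Forest (Fin d), ∃ C : ℝ, ∀ s t, s ≠ t →
    |X s t (basisForest ζ)| / |(t : ℝ) - (s : ℝ)| ^ (γ * (ζ.size : ℝ)) ≤ C

/-- The set of `d`-dimensional `γ`-Hölder branched rough paths on `[0,T]`. -/
def branchedRoughPaths (d : ℕ) (γ T : ℝ) :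
    Set (Set.Icc (0 : ℝ) T → Set.Icc (0 : ℝ) T → Module.Dual ℝ (ForestSpace d)) :=
  {X | IsBranchedRoughPath γ T X}

/-! ### The regularity structure

Index set `A = γ ℕ₀` (levels are indexed below by `k : ℕ` instead of `kγ`), model space
`T = ⟨𝓕_d⟩ = ⨁ₖ T_{kγ}`, and structure group the operators `(g ⊗ id) Δ_⋆`, `g` a character. -/

/-- The homogeneous component `T_{kγ}` of the model space: the span of the forests with `k`
vertices. It is finite-dimensional. -/
def level (d k : ℕ) : Submodule ℝ (ForestSpace d) :=
  Submodule.span ℝ (basisForest '' {ζ : Forest (Fin d) | ζ.size = k})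

/-- The norm `‖x‖ = √⟨x, x⟩` for the inner product in which the forests are orthonormal. -/
def forestNorm (x : ForestSpace d) : ℝ := √(x.coeff.sum fun _ c => c ^ 2)

/-- The canonical projection of the model space onto its `k`-th homogeneous component. -/
def levelProj (k : ℕ) (x : ForestSpace d) : ForestSpace d :=
  MonoidAlgebra.ofCoeff (x.coeff.filter fun ζ => ζ.size = k)

/-- The seminorm `‖x‖_{kγ}`, the norm of the `k`-th homogeneous component. -/
def levelNorm (k : ℕ) (x : ForestSpace d) : ℝ := forestNorm (levelProj k x)

/-- The structure group: the operators `(g ⊗ id) Δ_⋆` with `g` a character of the forest algebra,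
i.e. a unital algebra homomorphism to `ℝ`. -/
def structureGroup (d : ℕ) : Set (ForestSpace d →ₗ[ℝ] ForestSpace d) :=
  {Φ | ∃ g : ForestSpace d →ₐ[ℝ] ℝ, Φ = leftAction g.toLinearMap}

/-! ### Models on the real line -/

/-- `Γ : ℝ × ℝ → G`, with `G` the structure group, satisfies the algebraic and analytic conditions
required of the second component of a model. -/
structure IsBimap (γ : ℝ) (Γ : ℝ → ℝ → ForestSpace d →ₗ[ℝ] ForestSpace d) : Prop where
  mem : ∀ s t, Γ s t ∈ structureGroup d
  diag : ∀ s, Γ s s = LinearMap.id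
  comp : ∀ s u t, Γ s u ∘ₗ Γ u t = Γ s t
  bound : ∀ K : Set ℝ, IsCompact K → ∀ k : ℕ, ∃ C : ℝ,
    ∀ s ∈ K, ∀ t ∈ K, ∀ a ∈ level d k, ∀ m : ℕ, m < k →
      levelNorm m (Γ s t a) ≤ C * forestNorm a * |s - t| ^ (γ * (k : ℝ) - γ * (m : ℝ))

/-- Real tempered distributions on `ℝ`. -/
abbrev Tempered : Type := 𝓢(ℝ, ℝ) →L[ℝ] ℝ

/-- The recentred and rescaled function `y ↦ δ⁻¹ u (δ⁻¹ (y - s))`, for `δ ≠ 0`. -/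
def rescale (s δ : ℝ) (hδ : δ ≠ 0) (u : 𝓢(ℝ, ℝ)) : 𝓢(ℝ, ℝ) :=
  δ⁻¹ • SchwartzMap.compSubConstCLM ℝ s (SchwartzMap.compCLMOfContinuousLinearEquiv ℝ
    (ContinuousLinearEquiv.unitsEquivAut ℝ (Units.mk0 δ⁻¹ (inv_ne_zero hδ))) u)

theorem rescale_apply (s δ : ℝ) (hδ : δ ≠ 0) (u : 𝓢(ℝ, ℝ)) (y : ℝ) :
    rescale s δ hδ u y = δ⁻¹ * u (δ⁻¹ * (y - s)) := by
  simp [rescale, mul_comm]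

/-- The test functions: smooth `u` with compact support in the open ball `B(0,1)` and
`‖u‖_{C^1} ≤ 1`. (The order `1` is the smallest integer `r > |min A| = 0`.) -/
def testFunctions : Set 𝓢(ℝ, ℝ) :=
  {u | tsupport u ⊆ Metric.ball 0 1 ∧ ∀ y, |u y| ≤ 1 ∧ |deriv u y| ≤ 1}

/-- `(Π, Γ)` is a model on `ℝ` for the Connes–Kreimer regularity structure. -/
structure IsModel (γ : ℝ) (P : ℝ → ForestSpace d →ₗ[ℝ] Tempered)
    (Γ : ℝ → ℝ → ForestSpace d →ₗ[ℝ] ForestSpace d) : Prop where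
  bimap : IsBimap γ Γ
  comp : ∀ s t, P s ∘ₗ Γ s t = P t
  bound : ∀ K : Set ℝ, IsCompact K → ∀ k : ℕ, ∃ C : ℝ,
    ∀ s ∈ K, ∀ δ : ℝ, ∀ hδ : 0 < δ, δ ≤ 1 → ∀ a ∈ level d k, ∀ u ∈ testFunctions,
      |P s a (rescale s δ hδ.ne' u)| ≤ C * forestNorm a * δ ^ (γ * (k : ℝ))

/-- The tempered distribution `ξ` is (given by integration against) the continuous function `f`. -/
def IsContinuousFunction (ξ : Tempered) (f : ℝ → ℝ) : Prop :=
  Continuous f ∧ ∀ u : 𝓢(ℝ, ℝ),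
    MeasureTheory.Integrable (fun t => f t * u t) ∧ ξ u = ∫ t, f t * u t

/-- The models `(Π, Γ)` on `ℝ` such that `Π_s 1` is the constant function one for every `s` and such
that `Γ_{st} = id` for `s, t ∈ (-∞, 0]` and for `s, t ∈ [T, ∞)`. -/
def normalizedModels (d : ℕ) (γ T : ℝ) :
    Set ((ℝ → ForestSpace d →ₗ[ℝ] Tempered) ×
      (ℝ → ℝ → ForestSpace d →ₗ[ℝ] ForestSpace d)) :=
  {M | IsModel γ M.1 M.2 ∧
    (∀ s, IsContinuousFunction (M.1 s 1) fun _ => 1) ∧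
    (∀ s t, s ≤ 0 → t ≤ 0 → M.2 s t = LinearMap.id) ∧
    (∀ s t, T ≤ s → T ≤ t → M.2 s t = LinearMap.id)}

/-- The relation between `X` and `(Π, Γ)`: for `s, t ∈ [0,T]` and `x` in the forest space, `Π_s x` is
a continuous function with `(Π_s x)(t) = X_{st}(x)`, and `Γ_{st} x = (X_{ts} ⊗ id) Δ_⋆ x`. -/
def Corresponds {T : ℝ}
    (X : Set.Icc (0 : ℝ) T → Set.Icc (0 : ℝ) T → Module.Dual ℝ (ForestSpace d))
    (M : (ℝ → ForestSpace d →ₗ[ℝ] Tempered) ×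
      (ℝ → ℝ → ForestSpace d →ₗ[ℝ] ForestSpace d)) : Prop :=
  (∀ (s : Set.Icc (0 : ℝ) T) (x : ForestSpace d), ∃ f : ℝ → ℝ,
    IsContinuousFunction (M.1 s x) f ∧ ∀ t : Set.Icc (0 : ℝ) T, f t = X s t x) ∧
  (∀ (s t : Set.Icc (0 : ℝ) T) (x : ForestSpace d), M.2 s t x = leftAction (X t s) x)

end ConnesKreimer

end

open ConnesKreimer

namespace ConnesKreimer

variable {d : ℕ}

/-! ### Forests -/

namespace Forest

variable {I : Type}

/-! A character `g` and its operator `(g ⊗ id) Δ_⋆` determine each other: applying the counit to the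
operator returns `g` (`counit_leftAction`), and composing operators corresponds to convolving
characters in reverse order (`leftAction_comp`). Hence Chen's relation for `X` is the cocycle
relation for `Γ_{st} = (X_{ts} ⊗ id) Δ_⋆`, with inverse `X_{st} = ε ∘ Γ_{ts}`. The Hölder bounds
also match: `Δ_⋆` is graded, so a coefficient of `Γ_{st} ζ` at `ζ'` only involves values of `X` on
forests with `|ζ| - |ζ'|` vertices (`exists_coeff_leftAction_le`), while conversely `ε` reads the
component at level `0` (`exists_counit_le`).

From `X` to a model, time is projected onto `[0,T]`. Then `Π_s x = X_{s·}(x)` is a bounded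
continuous function, and `Π_s Γ_{st} = Π_t` is again Chen's relation.

For bijectivity and uniqueness, a normalized model must be determined by `Γ` on `[0,T]`. Outside
this interval the cocycle relation and the normalization determine `Γ`
(`map_projIcc_of_mem_normalizedModels`). `Π` is then determined as in the uniqueness part of the
reconstruction theorem: for two models with the same `Γ`, recentring `(Π_t - Π'_t) ζ` at any point
`s` leaves only nonempty forests, since `Π_s 1` is prescribed. So this distribution is `O(δ^γ)` at
scale `δ`, locally uniformly in `s`, and therefore zero (`Tempered.eq_zero_of_rescale_le`). -/

theorem induction {motive : Forest I → Prop} (one : motive 1)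
    (graft_mul : ∀ i a r, motive a → motive r → motive (graft i a * r)) (ζ : Forest I) :
    motive ζ := by
  obtain ⟨p⟩ := ζ
  induction p with
  | empty => exact one
  | cons i a r iha ihr => exact graft_mul i _ _ iha ihr

@[simp] theorem size_one : (1 : Forest I).size = 0 := rfl

@[simp] theorem size_graft (i : I) (a : Forest I) : (graft i a).size = a.size + 1 := by
  obtain ⟨p⟩ := a
  rfl

theorem size_graft_mul (i : I) (a r : Forest I) :
    (graft i a * r).size = a.size + 1 + r.size := by
  obtain ⟨p⟩ := a
  obtain ⟨q⟩ := r
  rfl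

@[simp] theorem size_mul (a b : Forest I) : (a * b).size = a.size + b.size := by
  induction a using induction with
  | one => simp
  | graft_mul i a r _ ih => rw [mul_assoc, size_graft_mul, size_graft_mul, ih]; omega

theorem size_eq_zero {a : Forest I} : a.size = 0 ↔ a = 1 := by
  refine ⟨fun h => ?_, fun h => h ▸ rfl⟩
  induction a using induction with
  | one => rfl
  | graft_mul i a r _ _ => rw [size_graft_mul] at h; omega

/-- Splitting off one tree writes a nonempty forest with at most `n + 1` vertices as `⌊a⌋ᵢ ⊙ r`,
where `a` and `r` have at most `n` vertices each. -/
theorem finite_size_le [Finite I] (n : ℕ) : {a : Forest I | a.size ≤ n}.Finite := by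
  induction n with
  | zero =>
    refine (Set.finite_singleton 1).subset fun a ha => ?_
    exact size_eq_zero.1 (Nat.le_zero.1 ha)
  | succ n ih =>
    refine (((Set.finite_univ (α := I)).prod (ih.prod ih)).image
      (fun p => graft p.1 p.2.1 * p.2.2)).union (Set.finite_singleton 1) |>.subset fun a ha => ?_
    induction a using induction with
    | one => exact Or.inr rfl
    | graft_mul i a r _ _ =>
      rw [Set.mem_ofPred_eq, size_graft_mul] at ha
      refine Or.inl ⟨(i, a, r), ⟨Set.mem_univ _, ?_, ?_⟩, rfl⟩ <;> simp only [Set.mem_ofPred_eq] <;>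
        omega

theorem finite_size_eq [Finite I] (n : ℕ) : {a : Forest I | a.size = n}.Finite :=
  (finite_size_le n).subset fun _ h => le_of_eq h

end Forest

/-! ### Characters and the left action -/

theorem basisForest_mul (a b : Forest (Fin d)) :
    basisForest (a * b) = basisForest a * basisForest b := by
  simp [basisForest, MonoidAlgebra.single_mul_single]

theorem basisForest_one : basisForest (1 : Forest (Fin d)) = 1 := rfl

theorem linearMap_ext {V : Type*} [AddCommMonoid V] [Module ℝ V] {f g : ForestSpace d →ₗ[ℝ] V}
    (h : ∀ ζ, f (basisForest ζ) = g (basisForest ζ)) : f = g := by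
  refine LinearMap.ext fun x => ?_
  induction x using MonoidAlgebra.induction_linear with
  | zero => simp
  | add x y hx hy => rw [map_add, map_add, hx, hy]
  | single ζ c =>
    have : (MonoidAlgebra.single ζ c : ForestSpace d) = c • basisForest ζ := by simp
    rw [this, map_smul, map_smul, h]

theorem graftLin_basisForest (i : Fin d) (ζ : Forest (Fin d)) :
    graftLin i (basisForest ζ) = basisForest (Forest.graft i ζ) := by
  simp [graftLin, basisForest]

/-- Trees generate the forest algebra, so multiplicative identities reduce to a single grafting
step. This is how the Hopf algebra identities below follow from the recursion of `Δ_⋆`. -/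
theorem algHom_ext_graft {A : Type*} [CommSemiring A] [Algebra ℝ A] {f g : ForestSpace d →ₐ[ℝ] A}
    (h : ∀ i ζ, f (basisForest ζ) = g (basisForest ζ) →
      f (basisForest (Forest.graft i ζ)) = g (basisForest (Forest.graft i ζ))) : f = g := by
  have key : ∀ ζ, f (basisForest ζ) = g (basisForest ζ) := by
    intro ζ
    induction ζ using Forest.induction with
    | one => rw [basisForest_one, map_one, map_one]
    | graft_mul i a r iha ihr => rw [basisForest_mul, map_mul, map_mul, h i a iha, ihr]
  have := linearMap_ext (f := f.toLinearMap) (g := g.toLinearMap) key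
  exact AlgHom.toLinearMap_injective this

/-- The left action of a character, as an algebra homomorphism. -/
noncomputable def leftActionHom (g : ForestSpace d →ₐ[ℝ] ℝ) : ForestSpace d →ₐ[ℝ] ForestSpace d :=
  ((Algebra.TensorProduct.lid ℝ (ForestSpace d)).toAlgHom.comp
    (Algebra.TensorProduct.map g (AlgHom.id ℝ (ForestSpace d)))).comp coproduct

theorem leftActionHom_apply (g : ForestSpace d →ₐ[ℝ] ℝ) (x : ForestSpace d) :
    leftActionHom g x = leftAction g.toLinearMap x := rfl

theorem leftActionHom_toLinearMap (g : ForestSpace d →ₐ[ℝ] ℝ) :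
    (leftActionHom g).toLinearMap = leftAction g.toLinearMap := rfl

theorem leftAction_graft (g : Module.Dual ℝ (ForestSpace d)) (i : Fin d) (ζ : Forest (Fin d)) :
    leftAction g (basisForest (Forest.graft i ζ)) =
      g (basisForest (Forest.graft i ζ)) • 1 + graftLin i (leftAction g (basisForest ζ)) := by
  have key : ∀ z : ForestSpace d ⊗[ℝ] ForestSpace d,
      (TensorProduct.lid ℝ (ForestSpace d)) (LinearMap.rTensor (ForestSpace d) g
        (LinearMap.lTensor (ForestSpace d) (graftLin i) z)) =
      graftLin i ((TensorProduct.lid ℝ (ForestSpace d))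
        (LinearMap.rTensor (ForestSpace d) g z)) := by
    intro z
    induction z with
    | zero => simp
    | add x y hx hy => simp only [map_add, hx, hy]
    | tmul x y => simp
  simp only [leftAction, LinearMap.comp_apply, AlgHom.toLinearMap_apply, coproduct_graft, map_add,
    LinearEquiv.coe_coe, key]
  simp

theorem convolution_apply (g h : Module.Dual ℝ (ForestSpace d)) (x : ForestSpace d) :
    convolution g h x = h (leftAction g x) := by
  have key : ∀ z : ForestSpace d ⊗[ℝ] ForestSpace d,
      (TensorProduct.lid ℝ ℝ) (TensorProduct.map g h z) =
      h ((TensorProduct.lid ℝ (ForestSpace d)) (LinearMap.rTensor (ForestSpace d) g z)) := by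
    intro z
    induction z with
    | zero => simp
    | add x y hx hy => simp only [map_add, hx, hy]
    | tmul x y => simp
  exact key _

theorem counit_apply (x : ForestSpace d) : counit x = x.coeff 1 := rfl

open Classical in
theorem counit_basisForest (ζ : Forest (Fin d)) :
    counit (basisForest ζ) = if ζ = 1 then 1 else 0 := by
  rw [counit_apply, MonoidAlgebra.coeff_single, Finsupp.single_apply]

theorem counit_basisForest_of_ne {ζ : Forest (Fin d)} (h : ζ ≠ 1) :
    counit (basisForest ζ) = 0 := by
  classical rw [counit_basisForest, if_neg h]

theorem counit_one : counit (1 : ForestSpace d) = 1 := by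
  classical rw [← basisForest_one, counit_basisForest, if_pos rfl]

/-- The counit as a character. -/
noncomputable def counitHom : ForestSpace d →ₐ[ℝ] ℝ :=
  MonoidAlgebra.lift ℝ ℝ (Forest (Fin d))
    { toFun := fun ζ => counit (basisForest ζ)
      map_one' := counit_one
      map_mul' := fun a b => by
        classical
        have : a * b = 1 ↔ a = 1 ∧ b = 1 := by
          simp only [← Forest.size_eq_zero, Forest.size_mul]; omega
        simp only [counit_basisForest, this, ite_and, mul_ite, mul_one, mul_zero]
        split_ifs <;> rfl }

theorem counitHom_toLinearMap : (counitHom (d := d)).toLinearMap = counit :=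
  linearMap_ext fun _ => (MonoidAlgebra.lift_single _ _ _).trans (one_smul _ _)

theorem counit_graftLin (i : Fin d) (x : ForestSpace d) : counit (graftLin i x) = 0 := by
  have : counit ∘ₗ graftLin i = 0 := linearMap_ext fun ζ => by
    rw [LinearMap.comp_apply, graftLin_basisForest, counit_basisForest_of_ne]
    · rfl
    · rw [Ne, ← Forest.size_eq_zero, Forest.size_graft]; omega
  exact LinearMap.congr_fun this x

/-- The counit kills everything in the image of a grafting, so only the scalar term of
`leftAction_graft` survives. -/
theorem counit_leftAction (g : ForestSpace d →ₐ[ℝ] ℝ) (x : ForestSpace d) :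
    counit (leftAction g.toLinearMap x) = g x := by
  have : counitHom.comp (leftActionHom g) = g := algHom_ext_graft fun _ _ _ => by
    rw [AlgHom.comp_apply, leftActionHom_apply, leftAction_graft, ← AlgHom.toLinearMap_apply,
      counitHom_toLinearMap, map_add, counit_graftLin, map_smul, counit_one]
    simp
  rw [← counitHom_toLinearMap]
  exact AlgHom.congr_fun this x

theorem leftAction_counit : leftAction (counit (d := d)) = LinearMap.id := by
  have : leftActionHom (counitHom (d := d)) = AlgHom.id ℝ _ := algHom_ext_graft fun i _ h => by
    rw [leftActionHom_apply, leftAction_graft, ← leftActionHom_apply, h, AlgHom.id_apply,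
      AlgHom.id_apply, graftLin_basisForest, counitHom_toLinearMap, counit_basisForest_of_ne,
      zero_smul, zero_add]
    rw [Ne, ← Forest.size_eq_zero, Forest.size_graft]; omega
  rw [← counitHom_toLinearMap, ← leftActionHom_toLinearMap, this]
  rfl

/-- This is coassociativity tested on characters. Both sides are algebra homomorphisms, so one
grafting step suffices. -/
theorem leftAction_comp (g h k : ForestSpace d →ₐ[ℝ] ℝ)
    (hk : k.toLinearMap = convolution h.toLinearMap g.toLinearMap) :
    leftAction g.toLinearMap ∘ₗ leftAction h.toLinearMap = leftAction k.toLinearMap := by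
  have hk' : k = g.comp (leftActionHom h) := AlgHom.toLinearMap_injective <| hk.trans <|
    LinearMap.ext fun x => convolution_apply _ _ x
  -- The grafting recursion is needed for arbitrary vectors, because `leftAction h ζ` is no longer a
  -- single forest.
  have hl (i : Fin d) (x : ForestSpace d) :
      leftAction g.toLinearMap (graftLin i x) =
        g (graftLin i x) • 1 + graftLin i (leftAction g.toLinearMap x) := by
    have : leftAction g.toLinearMap ∘ₗ graftLin i =
        LinearMap.toSpanSingleton ℝ _ 1 ∘ₗ g.toLinearMap ∘ₗ graftLin i +
          graftLin i ∘ₗ leftAction g.toLinearMap := linearMap_ext fun ζ => by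
      simp only [LinearMap.comp_apply, LinearMap.add_apply, graftLin_basisForest, leftAction_graft]
      rfl
    exact LinearMap.congr_fun this x
  have h1 : leftAction g.toLinearMap (1 : ForestSpace d) = 1 := map_one (leftActionHom g)
  have : (leftActionHom g).comp (leftActionHom h) = leftActionHom k :=
    algHom_ext_graft fun i ζ ih => by
      simp only [AlgHom.comp_apply, leftActionHom_apply] at ih ⊢
      rw [leftAction_graft, leftAction_graft, map_add, map_smul, hl, ih, h1, ← add_assoc,
        ← add_smul]
      -- What remains is the coefficient of `1`: `h ⌊ζ⌋ᵢ + g ⌊(h ⊗ id) Δ_⋆ ζ⌋ᵢ = k ⌊ζ⌋ᵢ`.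
      congr 2
      rw [hk']
      simp only [AlgHom.toLinearMap_apply, AlgHom.comp_apply, leftActionHom_apply, leftAction_graft,
        map_add, map_smul, map_one, smul_eq_mul, mul_one]
  exact congrArg AlgHom.toLinearMap this

/-- The coproduct of a forest is a sum of pure tensors of forests with the same total size. -/
theorem exists_coproduct_eq (ζ : Forest (Fin d)) :
    ∃ l : List (Forest (Fin d) × Forest (Fin d)), (∀ p ∈ l, p.1.size + p.2.size = ζ.size) ∧
      coproduct (basisForest ζ) = (l.map fun p => basisForest p.1 ⊗ₜ[ℝ] basisForest p.2).sum := by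
  induction ζ using Forest.induction with
  | one => exact ⟨[(1, 1)], by simp, by rw [basisForest_one, map_one]; simp; rfl⟩
  | graft_mul i a r iha ihr =>
    obtain ⟨la, hla, ha⟩ := iha
    obtain ⟨lr, hlr, hr⟩ := ihr
    let l := (Forest.graft i a, (1 : Forest (Fin d))) :: la.map fun p => (p.1, Forest.graft i p.2)
    have hl : ∀ p ∈ l, p.1.size + p.2.size = a.size + 1 := by
      intro p hp
      rcases List.mem_cons.1 hp with rfl | hp
      · simp
      · obtain ⟨q, hq, rfl⟩ := List.mem_map.1 hp
        simp [← hla q hq, add_assoc]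
    have hc : coproduct (basisForest (Forest.graft i a)) =
        (l.map fun p => basisForest p.1 ⊗ₜ[ℝ] basisForest p.2).sum := by
      rw [coproduct_graft, ha, map_list_sum, List.map_map, List.map_cons, List.sum_cons,
        List.map_map]
      congr 3
      ext p
      simp [graftLin_basisForest]
    refine ⟨(l ×ˢ lr).map fun p => (p.1.1 * p.2.1, p.1.2 * p.2.2), ?_, ?_⟩
    · intro p hp
      obtain ⟨⟨q, q'⟩, hq, rfl⟩ := List.mem_map.1 hp
      have := List.mem_product.1 hq
      have h1 := hl _ this.1
      have h2 := hlr _ this.2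
      simp only [Forest.size_mul, Forest.size_graft]
      omega
    · rw [basisForest_mul, map_mul, hc, hr, List.map_map]
      clear hc hl
      induction l with
      | nil => simp
      | cons p l ih =>
        rw [List.product_cons, List.map_append, List.sum_append, ← ih, List.map_cons, List.sum_cons,
          add_mul, List.map_map, ← List.sum_map_mul_left]
        congr 3
        ext q
        simp only [Function.comp_apply, basisForest_mul, Algebra.TensorProduct.tmul_mul_tmul]

theorem leftAction_eq_sum {ζ : Forest (Fin d)} {l : List (Forest (Fin d) × Forest (Fin d))}
    (h : coproduct (basisForest ζ) = (l.map fun p => basisForest p.1 ⊗ₜ[ℝ] basisForest p.2).sum)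
    (g : Module.Dual ℝ (ForestSpace d)) :
    leftAction g (basisForest ζ) = (l.map fun p => g (basisForest p.1) • basisForest p.2).sum := by
  simp only [leftAction, LinearMap.comp_apply, AlgHom.toLinearMap_apply, h, map_list_sum,
    List.map_map]
  congr 2

open Filter Topology

/-! ### Compactly supported functions are dense in the Schwartz space -/

/-- A smooth function that vanishes on the unit ball and equals one far away. -/
noncomputable def outerCutoff (x : ℝ) : ℝ :=
  1 - (⟨1, 2, one_pos, one_lt_two⟩ : ContDiffBump (0 : ℝ)) x

theorem contDiff_outerCutoff {n : ℕ∞} : ContDiff ℝ n outerCutoff :=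
  contDiff_const.sub (ContDiffBump.contDiff _)

theorem outerCutoff_eq_zero {x : ℝ} (h : |x| ≤ 1) : outerCutoff x = 0 := by
  rw [outerCutoff, ContDiffBump.one_of_mem_closedBall, sub_self]
  simpa using h

theorem hasCompactSupport_one_sub_outerCutoff : HasCompactSupport fun x => 1 - outerCutoff x := by
  simpa [outerCutoff] using
    (⟨1, 2, one_pos, one_lt_two⟩ : ContDiffBump (0 : ℝ)).hasCompactSupport

theorem exists_iteratedDeriv_outerCutoff_le (i : ℕ) :
    ∃ B, ∀ x, |iteratedDeriv i outerCutoff x| ≤ B := by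
  let b : ContDiffBump (0 : ℝ) := ⟨1, 2, one_pos, one_lt_two⟩
  let c : 𝓢(ℝ, ℝ) := b.hasCompactSupport.toSchwartzMap b.contDiff
  refine ⟨1 + SchwartzMap.seminorm ℝ 0 i c, fun x => ?_⟩
  have h := SchwartzMap.norm_iteratedFDeriv_le_seminorm ℝ c i x
  rw [norm_iteratedFDeriv_eq_norm_iteratedDeriv] at h
  have e : iteratedDeriv i outerCutoff x =
      iteratedDeriv i (fun _ => (1 : ℝ)) x - iteratedDeriv i c x :=
    iteratedDeriv_fun_sub contDiffAt_const (c.contDiffAt i)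
  rw [e]
  refine (abs_sub _ _).trans (add_le_add ?_ h)
  rw [iteratedDeriv_const]
  split_ifs <;> simp

/-- The chain rule contributes the factor `(n + 1)⁻ⁱ ≤ 1`, so the bound is uniform in `n`. -/
theorem exists_iteratedFDeriv_outerCutoff_le (i : ℕ) : ∃ B, 0 ≤ B ∧ ∀ (n : ℕ) (x : ℝ),
    ‖iteratedFDeriv ℝ i (fun y => outerCutoff ((n + 1 : ℝ)⁻¹ * y)) x‖ ≤ B := by
  obtain ⟨B, hB⟩ := exists_iteratedDeriv_outerCutoff_le i
  have hB0 : 0 ≤ B := (abs_nonneg _).trans (hB 0)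
  refine ⟨B, hB0, fun n x => ?_⟩
  rw [norm_iteratedFDeriv_eq_norm_iteratedDeriv,
    iteratedDeriv_comp_const_mul (contDiff_outerCutoff (n := i)), norm_mul, norm_pow]
  refine (mul_le_mul_of_nonneg_left (hB _) (by positivity)).trans (mul_le_of_le_one_left hB0 ?_)
  refine pow_le_one₀ (norm_nonneg _) ?_
  rw [norm_inv, Real.norm_of_nonneg (by positivity)]
  exact inv_le_one_of_one_le₀ (by simp)

/-- The rescaled cutoff vanishes for `|x| < n + 1`; elsewhere `1 ≤ (n + 1)⁻¹ ‖x‖`, so one more power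
of `‖x‖` buys the decay in `n`. -/
theorem pow_mul_norm_iteratedFDeriv_outerCutoff_le (n i k : ℕ) (x : ℝ) {B : ℝ}
    (hB : ‖iteratedFDeriv ℝ i (fun y => outerCutoff ((n + 1 : ℝ)⁻¹ * y)) x‖ ≤ B) :
    ‖x‖ ^ k * ‖iteratedFDeriv ℝ i (fun y => outerCutoff ((n + 1 : ℝ)⁻¹ * y)) x‖ ≤
      B * (n + 1 : ℝ)⁻¹ * ‖x‖ ^ (k + 1) := by
  have hn : (0 : ℝ) < n + 1 := by positivity
  have hB0 : 0 ≤ B := (norm_nonneg _).trans hB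
  by_cases hx : |x| < n + 1
  · have : (fun y => outerCutoff ((n + 1 : ℝ)⁻¹ * y)) =ᶠ[𝓝 x] fun _ => 0 := by
      filter_upwards [(isOpen_lt continuous_abs continuous_const).mem_nhds hx] with y hy
      refine outerCutoff_eq_zero ?_
      rw [abs_mul, abs_of_pos (inv_pos.2 hn), inv_mul_le_one₀ hn]
      exact le_of_lt hy
    rw [(this.iteratedFDeriv ℝ i).self_of_nhds]
    have : iteratedFDeriv ℝ i (fun _ : ℝ => (0 : ℝ)) = 0 := iteratedFDeriv_fun_zero
    rw [this]
    simp only [Pi.zero_apply, norm_zero, mul_zero]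
    positivity
  · have hx : (1 : ℝ) ≤ (n + 1 : ℝ)⁻¹ * ‖x‖ := by
      rw [inv_mul_eq_div, one_le_div hn]; exact not_lt.1 hx
    calc _ ≤ ‖x‖ ^ k * B * 1 := by rw [mul_one]; gcongr
      _ ≤ ‖x‖ ^ k * B * ((n + 1 : ℝ)⁻¹ * ‖x‖) := by gcongr
      _ = _ := by ring

/-- The error of truncation is cutoff times `u`. By Leibniz's rule its seminorm of index `(k, l)` is
`O(1/n)`, with a constant built from the seminorms of `u` of weight `k + 1`. -/
theorem exists_seq_hasCompactSupport_tendsto (u : 𝓢(ℝ, ℝ)) :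
    ∃ v : ℕ → 𝓢(ℝ, ℝ), (∀ n, HasCompactSupport (v n)) ∧ Tendsto v atTop (𝓝 u) := by
  have hsupp : ∀ n : ℕ, HasCompactSupport fun x => (1 - outerCutoff ((n + 1 : ℝ)⁻¹ * x)) * u x := by
    intro n
    refine HasCompactSupport.mul_right ?_
    exact hasCompactSupport_one_sub_outerCutoff.comp_homeomorph
      (Homeomorph.mulLeft₀ ((n + 1 : ℝ)⁻¹) (by positivity))
  have hcut : ∀ n : ℕ, ∀ m : ℕ∞, ContDiff ℝ m fun x => outerCutoff ((n + 1 : ℝ)⁻¹ * x) := fun n m =>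
    contDiff_outerCutoff.comp (contDiff_const.mul contDiff_id)
  let v : ℕ → 𝓢(ℝ, ℝ) := fun n => (hsupp n).toSchwartzMap
    ((contDiff_const.sub (hcut n _)).mul (u.smooth _))
  refine ⟨v, hsupp, ?_⟩
  rw [(schwartz_withSeminorms ℝ ℝ ℝ).tendsto_nhds]
  rintro ⟨k, l⟩ ε hε
  choose B hB0 hB using exists_iteratedFDeriv_outerCutoff_le
  let C : ℝ := ∑ i ∈ Finset.range (l + 1),
    (l.choose i : ℝ) * B i * SchwartzMap.seminorm ℝ (k + 1) (l - i) u
  have hC : 0 ≤ C := Finset.sum_nonneg fun i _ =>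
    mul_nonneg (mul_nonneg (Nat.cast_nonneg _) (hB0 i)) (apply_nonneg _ _)
  have key : ∀ n : ℕ, SchwartzMap.seminorm ℝ k l (v n - u) ≤ C * (n + 1 : ℝ)⁻¹ := by
    intro n
    refine SchwartzMap.seminorm_le_bound ℝ k l _ (by positivity) fun x => ?_
    have e : ⇑(v n - u) = -fun y => outerCutoff ((n + 1 : ℝ)⁻¹ * y) * u y := by
      ext y
      change (1 - outerCutoff ((n + 1 : ℝ)⁻¹ * y)) * u y - u y = -(_ * u y)
      ring
    rw [e, iteratedFDeriv_neg, Pi.neg_apply, norm_neg]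
    refine (mul_le_mul_of_nonneg_left (norm_iteratedFDeriv_mul_le (hcut n l) (u.smooth l) x
      le_rfl) (by positivity)).trans ?_
    rw [Finset.mul_sum, Finset.sum_mul]
    refine Finset.sum_le_sum fun i _ => ?_
    have h1 := pow_mul_norm_iteratedFDeriv_outerCutoff_le n i k x (hB i n x)
    have h2 := SchwartzMap.le_seminorm ℝ (k + 1) (l - i) u x
    calc _ = (l.choose i : ℝ) *
          (‖x‖ ^ k * ‖iteratedFDeriv ℝ i (fun y => outerCutoff ((n + 1 : ℝ)⁻¹ * y)) x‖) *
          ‖iteratedFDeriv ℝ (l - i) u x‖ := by ring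
      _ ≤ (l.choose i : ℝ) * (B i * (n + 1 : ℝ)⁻¹ * ‖x‖ ^ (k + 1)) *
          ‖iteratedFDeriv ℝ (l - i) u x‖ := by gcongr
      _ = (l.choose i : ℝ) * B i * (n + 1 : ℝ)⁻¹ *
          (‖x‖ ^ (k + 1) * ‖iteratedFDeriv ℝ (l - i) u x‖) := by ring
      _ ≤ (l.choose i : ℝ) * B i * (n + 1 : ℝ)⁻¹ * SchwartzMap.seminorm ℝ (k + 1) (l - i) u := by
        have := hB0 i
        gcongr
      _ = _ := by ring
  have lim : Tendsto (fun n : ℕ => C * (n + 1 : ℝ)⁻¹) atTop (𝓝 0) := by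
    simpa [one_div] using (tendsto_one_div_add_atTop_nhds_zero_nat (𝕜 := ℝ)).const_mul C
  filter_upwards [lim.eventually (gt_mem_nhds hε)] with n hn
  exact (key n).trans_lt hn

theorem Tempered.eq_zero_of_hasCompactSupport {η : Tempered}
    (h : ∀ u : 𝓢(ℝ, ℝ), HasCompactSupport u → η u = 0) : η = 0 := by
  ext u
  obtain ⟨v, hv, hu⟩ := exists_seq_hasCompactSupport_tendsto u
  have h1 := (η.continuous.tendsto u).comp hu
  have h2 : ⇑η ∘ v = fun _ => 0 := funext fun n => h _ (hv n)
  rw [h2] at h1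
  exact tendsto_nhds_unique h1 tendsto_const_nhds

/-! ### Distributions that vanish at small scales -/

/-- A smooth bump whose integer translates form a partition of unity. -/
noncomputable def unitBump (y : ℝ) : ℝ :=
  Real.smoothTransition (2 * (y + 3 / 4)) - Real.smoothTransition (2 * (y - 1 / 4))

theorem contDiff_unitBump {n : ℕ∞} : ContDiff ℝ n unitBump :=
  (Real.smoothTransition.contDiff.comp (contDiff_const.mul (contDiff_id.add contDiff_const))).sub
    (Real.smoothTransition.contDiff.comp (contDiff_const.mul (contDiff_id.sub contDiff_const)))

theorem unitBump_eq_zero {y : ℝ} (h : 3 / 4 ≤ |y|) : unitBump y = 0 := by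
  rcases le_abs.1 h with h | h
  · rw [unitBump, Real.smoothTransition.one_of_one_le (by linarith),
      Real.smoothTransition.one_of_one_le (by linarith), sub_self]
  · rw [unitBump, Real.smoothTransition.zero_of_nonpos (by linarith),
      Real.smoothTransition.zero_of_nonpos (by linarith), sub_self]

theorem tsupport_mul_unitBump_subset (f : ℝ → ℝ) :
    tsupport (fun z => f z * unitBump z) ⊆ Metric.closedBall 0 (3 / 4) := by
  refine closure_minimal (fun z hz => ?_) Metric.isClosed_closedBall
  by_contra h
  rw [Metric.mem_closedBall, dist_zero_right, Real.norm_eq_abs, not_le] at h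
  exact hz (by simp [unitBump_eq_zero h.le])

/-- The bump is the difference of a smooth step and its translate by `1`, so the sum telescopes; the
two remaining steps are `1` and `0` on `|y| ≤ N`. -/
theorem sum_unitBump {N : ℕ} {y : ℝ} (h : |y| ≤ N) :
    ∑ j ∈ Finset.range (2 * N + 1), unitBump (y - (j - N)) = 1 := by
  have h' := abs_le.1 h
  have e : ∀ j : ℕ, unitBump (y - (j - N)) =
      Real.smoothTransition (2 * (y + N - j + 3 / 4)) -
        Real.smoothTransition (2 * (y + N - (j + 1 : ℕ) + 3 / 4)) := by
    intro j
    rw [unitBump]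
    congr 2
    · ring
    · push_cast; ring
  rw [Finset.sum_congr rfl fun j _ => e j, Finset.sum_range_sub',
    Real.smoothTransition.one_of_one_le, Real.smoothTransition.zero_of_nonpos, sub_zero]
  · push_cast; linarith
  · push_cast; linarith

theorem exists_unitBump_le : ∃ B, 0 ≤ B ∧ ∀ z, |unitBump z| ≤ B ∧ |deriv unitBump z| ≤ B := by
  have hs : HasCompactSupport unitBump := by
    have := tsupport_mul_unitBump_subset fun _ => 1
    simp only [one_mul] at this
    exact (isCompact_closedBall _ _).of_isClosed_subset (isClosed_tsupport _) this
  let w : 𝓢(ℝ, ℝ) := hs.toSchwartzMap contDiff_unitBump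
  obtain ⟨B₀, h₀⟩ : ∃ B, ∀ z, |unitBump z| ≤ B :=
    ⟨_, fun z => SchwartzMap.norm_le_seminorm ℝ w z⟩
  obtain ⟨B₁, h₁⟩ : ∃ B, ∀ z, |deriv unitBump z| ≤ B :=
    ⟨_, fun z => SchwartzMap.norm_le_seminorm ℝ (SchwartzMap.derivCLM ℝ ℝ w) z⟩
  exact ⟨max B₀ B₁, (abs_nonneg _).trans ((h₀ 0).trans (le_max_left _ _)), fun z =>
    ⟨(h₀ z).trans (le_max_left _ _), (h₁ z).trans (le_max_right _ _)⟩⟩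

/-- A Schwartz function localised by a partition of unity at scale `δ` is, up to a factor, a
rescaled test function. -/
theorem exists_localized (u : 𝓢(ℝ, ℝ)) : ∃ M, 0 < M ∧ ∀ r δ : ℝ, 0 < δ → δ ≤ 1 →
    ∃ v ∈ testFunctions, ∀ z, M * v z = u (r + δ * z) * unitBump z := by
  obtain ⟨B, hB0, hB⟩ := exists_unitBump_le
  let U₀ := SchwartzMap.seminorm ℝ 0 0 u
  let U₁ := SchwartzMap.seminorm ℝ 0 0 (SchwartzMap.derivCLM ℝ ℝ u)
  have h₀ : ∀ z, |u z| ≤ U₀ := fun z => SchwartzMap.norm_le_seminorm ℝ u z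
  have h₁ : ∀ z, |deriv u z| ≤ U₁ := fun z =>
    SchwartzMap.norm_le_seminorm ℝ (SchwartzMap.derivCLM ℝ ℝ u) z
  have hU₀ : 0 ≤ U₀ := apply_nonneg _ _
  have hU₁ : 0 ≤ U₁ := apply_nonneg _ _
  -- The first two terms bound the derivative of the localized function, where `δ ≤ 1` absorbs the
  -- chain rule factor; the `1` makes `M` positive.
  let M := U₀ * B + U₁ * B + 1
  have hM : 0 < M := by positivity
  refine ⟨M, hM, fun r δ hδ hδ1 => ?_⟩
  let f : ℝ → ℝ := fun z => u (r + δ * z) * unitBump z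
  have hf : ContDiff ℝ ((⊤ : ℕ∞) : WithTop ℕ∞) f :=
    ((u.smooth ⊤).comp (contDiff_const.add (contDiff_const.mul contDiff_id))).mul contDiff_unitBump
  have hsub : tsupport f ⊆ Metric.closedBall 0 (3 / 4) := tsupport_mul_unitBump_subset _
  have hs : HasCompactSupport f :=
    (isCompact_closedBall _ _).of_isClosed_subset (isClosed_tsupport _) hsub
  let w : 𝓢(ℝ, ℝ) := hs.toSchwartzMap hf
  have hd : ∀ z, deriv f z = deriv u (r + δ * z) * δ * unitBump z +
      u (r + δ * z) * deriv unitBump z := by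
    intro z
    have hl : HasDerivAt (fun z => r + δ * z) δ z := by
      simpa using ((hasDerivAt_id z).const_mul δ).const_add r
    have hb : HasDerivAt unitBump (deriv unitBump z) z :=
      ((contDiff_unitBump (n := 1)).differentiable (by simp) z).hasDerivAt
    exact (((u.hasDerivAt (r + δ * z)).comp z hl).mul hb).deriv
  refine ⟨M⁻¹ • w, ⟨?_, fun z => ?_⟩, fun z => ?_⟩
  · refine (closure_mono ?_).trans (hsub.trans (Metric.closedBall_subset_ball (by norm_num)))
    intro z hz h
    refine hz ?_
    change M⁻¹ * f z = 0
    rw [h, mul_zero]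
  · have hw : ⇑(M⁻¹ • w) = fun z => M⁻¹ * f z := rfl
    rw [hw, deriv_const_mul _ (hf.differentiable (by simp) z), abs_mul, abs_mul (M⁻¹),
      abs_of_pos (inv_pos.2 hM), inv_mul_le_one₀ hM, inv_mul_le_one₀ hM, hd]
    have b0 : |u (r + δ * z) * unitBump z| ≤ U₀ * B := by
      rw [abs_mul]; exact mul_le_mul (h₀ _) (hB z).1 (abs_nonneg _) hU₀
    have b1 : |u (r + δ * z) * deriv unitBump z| ≤ U₀ * B := by
      rw [abs_mul]; exact mul_le_mul (h₀ _) (hB z).2 (abs_nonneg _) hU₀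
    have b2 : |deriv u (r + δ * z) * δ * unitBump z| ≤ U₁ * B := by
      rw [abs_mul, abs_mul, abs_of_pos hδ]
      refine mul_le_mul ?_ (hB z).1 (abs_nonneg _) hU₁
      exact (mul_le_of_le_one_right (abs_nonneg _) hδ1).trans (h₁ _)
    have : 0 ≤ U₀ * B := by positivity
    have : 0 ≤ U₁ * B := by positivity
    refine ⟨b0.trans (by simp only [M]; linarith), (abs_add_le _ _).trans ?_⟩
    simp only [M]; linarith
  · change M * (M⁻¹ * f z) = f z
    rw [mul_inv_cancel_left₀ hM.ne']

/-- A partition of unity at scale `δ` cuts a compactly supported `u` into `O(1/δ)` pieces, each `δ`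
times a bounded multiple of a rescaled test function. The number of pieces cancels the weight `δ`,
so `|η u| = O(δ^γ)` for every `δ = 1/(n + 1)`. -/
theorem Tempered.eq_zero_of_rescale_le {η : Tempered} {γ : ℝ} (hγ : 0 < γ)
    (h : ∀ K : Set ℝ, IsCompact K → ∃ C : ℝ, ∀ s ∈ K, ∀ δ : ℝ, ∀ hδ : 0 < δ, δ ≤ 1 →
      ∀ u ∈ testFunctions, |η (rescale s δ hδ.ne' u)| ≤ C * δ ^ γ) : η = 0 := by
  refine Tempered.eq_zero_of_hasCompactSupport fun u hu => ?_
  obtain ⟨R, hR⟩ : ∃ R : ℕ, ∀ y, (R : ℝ) < |y| → u y = 0 := by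
    obtain ⟨R, hR⟩ := hu.isBounded.subset_closedBall (0 : ℝ)
    obtain ⟨n, hn⟩ := exists_nat_ge R
    refine ⟨n, fun y hy => image_eq_zero_of_notMem_tsupport fun hy' => ?_⟩
    have := hR hy'
    rw [Metric.mem_closedBall, dist_zero_right, Real.norm_eq_abs] at this
    linarith
  obtain ⟨C, hC⟩ := h (Set.Icc (-R) R) isCompact_Icc
  obtain ⟨M, hM, hv⟩ := exists_localized u
  have key : ∀ n : ℕ, |η u| ≤ (2 * R + 1) * M * |C| * ((n + 1 : ℝ)⁻¹) ^ γ := by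
    intro n
    have hn : (0 : ℝ) < n + 1 := by positivity
    set δ : ℝ := (n + 1 : ℝ)⁻¹ with hδdef
    have hδ : 0 < δ := inv_pos.2 hn
    have hδ1 : δ ≤ 1 := inv_le_one_of_one_le₀ (by simp)
    have hnδ : ((n : ℝ) + 1) * δ = 1 := mul_inv_cancel₀ hn.ne'
    -- With `δ N = R`, the centres `δ (j - N)`, `j ≤ 2N`, form a grid of mesh `δ` from `-R` to `R`.
    let N : ℕ := (n + 1) * R
    have hN : (N : ℝ) = (n + 1) * R := by simp [N]
    let r : ℕ → ℝ := fun j => δ * (j - N)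
    choose v hvt hvz using fun j : ℕ => hv (r j) δ hδ hδ1
    have hr : ∀ j ∈ Finset.range (2 * N + 1), r j ∈ Set.Icc (-R : ℝ) R := by
      intro j hj
      have hj : (j : ℝ) ≤ 2 * N := by exact_mod_cast Nat.lt_succ_iff.1 (Finset.mem_range.1 hj)
      have hRN : δ * N = R := by rw [hN, ← mul_assoc, mul_comm δ, hnδ, one_mul]
      have hj0 : (0 : ℝ) ≤ j := Nat.cast_nonneg j
      constructor
      · have := mul_le_mul_of_nonneg_left (show -(N : ℝ) ≤ j - N by linarith) hδ.le
        simp only [r]; linarith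
      · have := mul_le_mul_of_nonneg_left (show (j : ℝ) - N ≤ N by linarith) hδ.le
        simp only [r]; linarith
    -- The weight undoes the factor `δ⁻¹` in `rescale` and the normalization by `M`.
    have hu : u = ∑ j ∈ Finset.range (2 * N + 1), (δ * M) • rescale (r j) δ hδ.ne' (v j) := by
      ext y
      rw [_root_.sum_apply]
      have e : ∀ j : ℕ, ((δ * M) • rescale (r j) δ hδ.ne' (v j)) y =
          u y * unitBump ((n + 1) * y - (j - N)) := by
        intro j
        rw [_root_.smul_apply, rescale_apply, smul_eq_mul]
        have e1 : δ⁻¹ * (y - r j) = (n + 1) * y - (j - N) := by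
          simp only [r, hδdef, inv_inv, mul_sub]
          field_simp
        have e2 : r j + δ * (δ⁻¹ * (y - r j)) = y := by
          rw [mul_inv_cancel_left₀ hδ.ne']; ring
        have e3 := hvz j (δ⁻¹ * (y - r j))
        rw [e2] at e3
        rw [← e1, ← e3]
        field_simp
      rw [Finset.sum_congr rfl fun j _ => e j, ← Finset.mul_sum]
      by_cases hy : (R : ℝ) < |y|
      · rw [hR y hy, zero_mul]
      · rw [sum_unitBump, mul_one]
        rw [hN, abs_mul, abs_of_pos hn]
        exact mul_le_mul_of_nonneg_left (not_lt.1 hy) hn.le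
    have hterm : ∀ j ∈ Finset.range (2 * N + 1),
        |η ((δ * M) • rescale (r j) δ hδ.ne' (v j))| ≤ δ * M * (|C| * δ ^ γ) := by
      intro j hj
      rw [map_smul, smul_eq_mul, abs_mul, abs_of_pos (mul_pos hδ hM)]
      refine mul_le_mul_of_nonneg_left ((hC _ (hr j hj) δ hδ hδ1 _ (hvt j)).trans ?_)
        (by positivity)
      exact mul_le_mul_of_nonneg_right (le_abs_self C) (by positivity)
    calc |η u| = |∑ j ∈ Finset.range (2 * N + 1), η ((δ * M) • rescale (r j) δ hδ.ne' (v j))| := by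
          rw [← map_sum, ← hu]
      _ ≤ ∑ j ∈ Finset.range (2 * N + 1), δ * M * (|C| * δ ^ γ) :=
          (Finset.abs_sum_le_sum_abs _ _).trans (Finset.sum_le_sum hterm)
      _ = (2 * R * ((n + 1) * δ) + δ) * M * |C| * δ ^ γ := by
          rw [Finset.sum_const, Finset.card_range, nsmul_eq_mul]
          push_cast
          rw [hN]
          ring
      _ ≤ (2 * R + 1) * M * |C| * δ ^ γ := by
          rw [hnδ, mul_one]
          gcongr
  have lim : Tendsto (fun n : ℕ => (2 * R + 1) * M * |C| * ((n + 1 : ℝ)⁻¹) ^ γ) atTop (𝓝 0) := by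
    have h1 : Tendsto (fun n : ℕ => (n + 1 : ℝ)⁻¹) atTop (𝓝 0) := by
      simpa [one_div] using tendsto_one_div_add_atTop_nhds_zero_nat (𝕜 := ℝ)
    have h2 := (h1.rpow_const (p := γ) (Or.inr hγ.le)).const_mul ((2 * R + 1) * M * |C|)
    rwa [Real.zero_rpow hγ.ne', mul_zero] at h2
  exact abs_nonpos_iff.1 (ge_of_tendsto' lim key)

/-! ### Norms on the forest space -/

/-- The finite set of forests with `k` vertices. -/
noncomputable def forestsOfSize (d k : ℕ) : Finset (Forest (Fin d)) :=
  (Forest.finite_size_eq k).toFinset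

theorem mem_forestsOfSize {k : ℕ} {ζ : Forest (Fin d)} : ζ ∈ forestsOfSize d k ↔ ζ.size = k := by
  simp [forestsOfSize]

theorem forestNorm_nonneg (x : ForestSpace d) : 0 ≤ forestNorm x := Real.sqrt_nonneg _

theorem abs_coeff_le_forestNorm (x : ForestSpace d) (ζ : Forest (Fin d)) :
    |x.coeff ζ| ≤ forestNorm x := by
  by_cases h : ζ ∈ x.coeff.support
  · refine Real.abs_le_sqrt ?_
    exact Finset.single_le_sum (f := fun ζ => x.coeff ζ ^ 2) (fun _ _ => sq_nonneg _) h
  · rw [Finsupp.notMem_support_iff.1 h, abs_zero]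
    exact forestNorm_nonneg x

theorem forestNorm_le_sum_abs {x : ForestSpace d} {S : Finset (Forest (Fin d))}
    (h : x.coeff.support ⊆ S) : forestNorm x ≤ ∑ ζ ∈ S, |x.coeff ζ| := by
  refine Real.sqrt_le_iff.2 ⟨Finset.sum_nonneg fun _ _ => abs_nonneg _, ?_⟩
  rw [Finsupp.sum_of_support_subset _ h _ fun _ _ => by simp]
  have := Finset.sum_sq_le_sq_sum_of_nonneg (s := S) (f := fun ζ => |x.coeff ζ|)
    fun _ _ => abs_nonneg _
  simpa only [sq_abs] using this

theorem coeff_levelProj (k : ℕ) (x : ForestSpace d) (ζ : Forest (Fin d)) :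
    (levelProj k x).coeff ζ = if ζ.size = k then x.coeff ζ else 0 := by
  classical
  change (x.coeff.filter _) ζ = _
  rw [Finsupp.filter_apply]

theorem levelNorm_le_sum_abs (k : ℕ) (x : ForestSpace d) :
    levelNorm k x ≤ ∑ ζ ∈ forestsOfSize d k, |x.coeff ζ| := by
  refine (forestNorm_le_sum_abs (S := forestsOfSize d k) fun ζ hζ => ?_).trans_eq
    (Finset.sum_congr rfl fun ζ hζ => ?_)
  · rw [Finsupp.mem_support_iff, coeff_levelProj] at hζ
    exact mem_forestsOfSize.2 (by_contra fun h => hζ (if_neg h))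
  · rw [coeff_levelProj, if_pos (mem_forestsOfSize.1 hζ)]

theorem abs_counit_le_levelNorm (x : ForestSpace d) : |counit x| ≤ levelNorm 0 x := by
  have := abs_coeff_le_forestNorm (levelProj 0 x) 1
  rwa [coeff_levelProj, if_pos Forest.size_one] at this

theorem basisForest_mem_level (ζ : Forest (Fin d)) : basisForest ζ ∈ level d ζ.size :=
  Submodule.subset_span ⟨ζ, rfl, rfl⟩

theorem eq_sum_of_mem_level {k : ℕ} {a : ForestSpace d} (ha : a ∈ level d k) :
    a = ∑ ζ ∈ forestsOfSize d k, a.coeff ζ • basisForest ζ := by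
  induction ha using Submodule.span_induction with
  | mem x hx =>
    obtain ⟨ζ, hζ, rfl⟩ := hx
    rw [Finset.sum_eq_single_of_mem ζ (mem_forestsOfSize.2 hζ)]
    · simp
    · intro b _ hb
      classical rw [MonoidAlgebra.coeff_single, Finsupp.single_apply, if_neg hb.symm, zero_smul]
  | zero => simp
  | add x y _ _ hx hy =>
    conv_lhs => rw [hx, hy]
    simp only [MonoidAlgebra.coeff_add, Finsupp.add_apply, add_smul, Finset.sum_add_distrib]
  | smul c x _ hx =>
    conv_lhs => rw [hx]
    simp only [MonoidAlgebra.coeff_smul, Finsupp.smul_apply, smul_assoc, Finset.smul_sum]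

/-- Levels are finite-dimensional, so this reduces both model bounds to single forests. -/
theorem abs_le_of_mem_level {k : ℕ} {a : ForestSpace d} (ha : a ∈ level d k)
    (Φ : Module.Dual ℝ (ForestSpace d)) :
    |Φ a| ≤ forestNorm a * ∑ ζ ∈ forestsOfSize d k, |Φ (basisForest ζ)| := by
  conv_lhs => rw [eq_sum_of_mem_level ha]
  rw [map_sum, Finset.mul_sum]
  refine (Finset.abs_sum_le_sum_abs _ _).trans (Finset.sum_le_sum fun ζ _ => ?_)
  rw [map_smul, smul_eq_mul, abs_mul]
  exact mul_le_mul_of_nonneg_right (abs_coeff_le_forestNorm a ζ) (abs_nonneg _)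

/-! ### Branched rough paths as families of characters -/

namespace IsBranchedRoughPath

variable {γ T : ℝ} {X : Set.Icc (0 : ℝ) T → Set.Icc (0 : ℝ) T → Module.Dual ℝ (ForestSpace d)}

/-- The values of a branched rough path are characters. -/
noncomputable def char (hX : IsBranchedRoughPath γ T X) (s t : Set.Icc (0 : ℝ) T) :
    ForestSpace d →ₐ[ℝ] ℝ :=
  MonoidAlgebra.lift ℝ ℝ (Forest (Fin d))
    { toFun := fun ζ => X s t (basisForest ζ)
      map_one' := hX.map_one s t
      map_mul' := fun a b => by rw [basisForest_mul, hX.map_mul] }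

theorem char_toLinearMap (hX : IsBranchedRoughPath γ T X) (s t : Set.Icc (0 : ℝ) T) :
    (hX.char s t).toLinearMap = X s t :=
  linearMap_ext fun _ => (MonoidAlgebra.lift_single _ _ _).trans (one_smul _ _)

theorem counit_leftAction (hX : IsBranchedRoughPath γ T X) (s t : Set.Icc (0 : ℝ) T)
    (x : ForestSpace d) : counit (leftAction (X s t) x) = X s t x := by
  rw [← hX.char_toLinearMap, ConnesKreimer.counit_leftAction]
  rfl

theorem convolution_eq (hX : IsBranchedRoughPath γ T X) (s u t : Set.Icc (0 : ℝ) T) :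
    X s t = convolution (X s u) (X u t) :=
  linearMap_ext (hX.chen s u t)

theorem apply_leftAction (hX : IsBranchedRoughPath γ T X) (s u t : Set.Icc (0 : ℝ) T)
    (x : ForestSpace d) : X u t (leftAction (X s u) x) = X s t x := by
  rw [hX.convolution_eq s u t, convolution_apply]

theorem leftAction_comp (hX : IsBranchedRoughPath γ T X) (s u t : Set.Icc (0 : ℝ) T) :
    leftAction (X u t) ∘ₗ leftAction (X s u) = leftAction (X s t) := by
  have := ConnesKreimer.leftAction_comp (hX.char u t) (hX.char s u) (hX.char s t)
    (by simp only [char_toLinearMap]; exact hX.convolution_eq s u t)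
  simpa only [char_toLinearMap] using this

/-- The projection onto `[0,T]` is `1`-Lipschitz, so the Hölder bound survives the constant
extension. -/
theorem exists_holder (hX : IsBranchedRoughPath γ T X) (hγ : 0 < γ) (hT : 0 ≤ T)
    (ζ : Forest (Fin d)) : ∃ C, 0 ≤ C ∧ ∀ s t : ℝ,
      |X (Set.projIcc 0 T hT s) (Set.projIcc 0 T hT t) (basisForest ζ)| ≤
        C * |t - s| ^ (γ * (ζ.size : ℝ)) := by
  obtain ⟨C, hC⟩ := hX.holder ζ
  -- The `1` covers the empty forest at points with equal projections, where `X` is `1` and the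
  -- power has exponent `0`.
  refine ⟨max C 1, by positivity, fun s t => ?_⟩
  set p := Set.projIcc 0 T hT
  by_cases h : p s = p t
  · rw [h, hX.diag]
    by_cases hζ : ζ = 1
    · subst hζ
      simp [basisForest_one, counit_one]
    · rw [counit_basisForest_of_ne hζ, abs_zero]
      positivity
  · have h1 := hC _ _ h
    have hpos : 0 < |(p t : ℝ) - p s| := by
      rw [abs_pos, sub_ne_zero]
      exact fun e => h (Subtype.ext e.symm)
    rw [div_le_iff₀ (by positivity)] at h1
    have hp : |(p t : ℝ) - p s| ≤ |t - s| := Set.abs_projIcc_sub_projIcc hT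
    calc _ ≤ C * |(p t : ℝ) - p s| ^ (γ * (ζ.size : ℝ)) := h1
      _ ≤ max C 1 * |(p t : ℝ) - p s| ^ (γ * (ζ.size : ℝ)) := by
        gcongr; exact le_max_left _ _
      _ ≤ _ := by gcongr

theorem exists_bound (hX : IsBranchedRoughPath γ T X) (hγ : 0 < γ) (hT : 0 ≤ T)
    (x : ForestSpace d) : ∃ C, ∀ s t, |X s t x| ≤ C := by
  induction x using MonoidAlgebra.induction_linear with
  | zero => exact ⟨0, fun s t => by simp⟩
  | add x y hx hy =>
    obtain ⟨C, hC⟩ := hx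
    obtain ⟨D, hD⟩ := hy
    exact ⟨C + D, fun s t => by
      rw [map_add]; exact (abs_add_le _ _).trans (add_le_add (hC s t) (hD s t))⟩
  | single ζ c =>
    obtain ⟨C, hC0, hC⟩ := hX.exists_holder hγ hT ζ
    refine ⟨|c| * (C * T ^ (γ * (ζ.size : ℝ))), fun s t => ?_⟩
    have e : (MonoidAlgebra.single ζ c : ForestSpace d) = c • basisForest ζ := by simp
    have h := hC s t
    rw [Set.projIcc_val, Set.projIcc_val] at h
    rw [e, map_smul, smul_eq_mul, abs_mul]
    have : |(t : ℝ) - s| ≤ T := by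
      have := s.2.1; have := s.2.2; have := t.2.1; have := t.2.2
      rw [abs_le]; constructor <;> linarith
    refine mul_le_mul_of_nonneg_left (h.trans ?_) (abs_nonneg _)
    gcongr

/-- By Chen's relation `X_{sr}(x) = X_{tr}(y)` with `y = (X_{st} ⊗ id) Δ_⋆ x` independent of `r`.
Continuity at `t` thus reduces to `X_{tr} → ε` as `r → t`, which the Hölder bound gives. -/
theorem continuous_right (hX : IsBranchedRoughPath γ T X) (hγ : 0 < γ) (hT : 0 ≤ T)
    (s : Set.Icc (0 : ℝ) T) (x : ForestSpace d) :
    Continuous fun t : ℝ => X s (Set.projIcc 0 T hT t) x := by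
  set p := Set.projIcc 0 T hT
  have key : ∀ (t : ℝ) (y : ForestSpace d),
      Tendsto (fun r : ℝ => X (p t) (p r) y) (𝓝 t) (𝓝 (counit y)) := by
    intro t y
    induction y using MonoidAlgebra.induction_linear with
    | zero => simp
    | add x y hx hy => simpa only [map_add] using hx.add hy
    | single ζ c =>
      have e : (MonoidAlgebra.single ζ c : ForestSpace d) = c • basisForest ζ := by simp
      simp only [e, map_smul]
      refine Tendsto.const_smul ?_ c
      by_cases hζ : ζ = 1
      · subst hζ
        simp only [basisForest_one, counit_one, hX.map_one]
        exact tendsto_const_nhds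
      · rw [counit_basisForest_of_ne hζ]
        obtain ⟨C, hC0, hC⟩ := hX.exists_holder hγ hT ζ
        have hpos : 0 < γ * (ζ.size : ℝ) := by
          have : ζ.size ≠ 0 := fun h => hζ (Forest.size_eq_zero.1 h)
          positivity
        refine squeeze_zero_norm (hC t) ?_
        have h1 : Tendsto (fun r : ℝ => |r - t|) (𝓝 t) (𝓝 0) := by
          have : Continuous fun r : ℝ => |r - t| := by fun_prop
          simpa using this.tendsto t
        have h2 := (h1.rpow_const (p := γ * (ζ.size : ℝ)) (Or.inr hpos.le)).const_mul C
        rwa [Real.zero_rpow hpos.ne', mul_zero] at h2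
  refine continuous_iff_continuousAt.2 fun t => ?_
  have h := key t (leftAction (X s (p t)) x)
  simp only [hX.apply_leftAction, hX.counit_leftAction] at h
  exact h

/-- In `Δ_⋆ ζ` only terms with right factor `ζ'` contribute, and their left factors have `|ζ| -
|ζ'|` vertices. -/
theorem exists_coeff_leftAction_le (hX : IsBranchedRoughPath γ T X) (hγ : 0 < γ) (hT : 0 ≤ T)
    (ζ ζ' : Forest (Fin d)) : ∃ C, 0 ≤ C ∧ ∀ s t : ℝ,
      |(leftAction (X (Set.projIcc 0 T hT t) (Set.projIcc 0 T hT s)) (basisForest ζ)).coeff ζ'| ≤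
        C * |s - t| ^ (γ * (ζ.size : ℝ) - γ * (ζ'.size : ℝ)) := by
  obtain ⟨l, hl, hc⟩ := exists_coproduct_eq ζ
  simp only [leftAction_eq_sum hc]
  clear hc
  induction l with
  | nil => exact ⟨0, le_rfl, fun s t => by simp⟩
  | cons p l ih =>
    obtain ⟨C, hC0, hC⟩ := ih fun q hq => hl q (List.mem_cons_of_mem _ hq)
    obtain ⟨D, hD0, hD⟩ := hX.exists_holder hγ hT p.1
    refine ⟨D + C, by positivity, fun s t => ?_⟩
    rw [List.map_cons, List.sum_cons, MonoidAlgebra.coeff_add, Finsupp.add_apply, add_mul]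
    refine (abs_add_le _ _).trans (add_le_add ?_ (hC s t))
    rw [MonoidAlgebra.coeff_smul, Finsupp.smul_apply, MonoidAlgebra.coeff_single]
    by_cases h : p.2 = ζ'
    · subst h
      have e : γ * (ζ.size : ℝ) - γ * (p.2.size : ℝ) = γ * (p.1.size : ℝ) := by
        rw [← hl p List.mem_cons_self]; push_cast; ring
      rw [Finsupp.single_eq_same, smul_eq_mul, mul_one, e]
      exact hD t s
    · classical
      rw [Finsupp.single_apply, if_neg h, smul_zero, abs_zero]
      positivity

theorem isBimap (hX : IsBranchedRoughPath γ T X) (hγ : 0 < γ) (hT : 0 ≤ T) :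
    IsBimap γ fun s t => leftAction (X (Set.projIcc 0 T hT t) (Set.projIcc 0 T hT s)) where
  mem s t := ⟨hX.char _ _, by rw [hX.char_toLinearMap]⟩
  diag s := by rw [hX.diag, leftAction_counit]
  comp s u t := hX.leftAction_comp _ _ _
  bound K _ k := by
    choose C hC0 hC using hX.exists_coeff_leftAction_le hγ hT
    let D : ℕ → ℝ := fun m => ∑ ζ' ∈ forestsOfSize d m, ∑ ζ ∈ forestsOfSize d k, C ζ ζ'
    have hD : ∀ m, 0 ≤ D m := fun m =>
      Finset.sum_nonneg fun _ _ => Finset.sum_nonneg fun _ _ => hC0 _ _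
    -- The constant may not depend on `m`, hence the sum over all levels below `k`.
    refine ⟨∑ m ∈ Finset.range k, D m, fun s _ t _ a ha m hm => ?_⟩
    have hDm : D m ≤ ∑ m ∈ Finset.range k, D m :=
      Finset.single_le_sum (fun m _ => hD m) (Finset.mem_range.2 hm)
    refine le_trans ?_ (mul_le_mul_of_nonneg_right
      (mul_le_mul_of_nonneg_right hDm (forestNorm_nonneg a)) (by positivity))
    refine (levelNorm_le_sum_abs m _).trans ?_
    simp only [D]
    rw [Finset.sum_mul, Finset.sum_mul]
    refine Finset.sum_le_sum fun ζ' hζ' => ?_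
    have h := abs_le_of_mem_level ha ((Finsupp.lapply ζ' ∘ₗ
      (MonoidAlgebra.coeffLinearEquiv ℝ).toLinearMap) ∘ₗ
        leftAction (X (Set.projIcc 0 T hT t) (Set.projIcc 0 T hT s)))
    refine h.trans ?_
    rw [mul_comm _ (forestNorm a), mul_assoc, Finset.sum_mul]
    refine mul_le_mul_of_nonneg_left (Finset.sum_le_sum fun ζ hζ => ?_) (forestNorm_nonneg a)
    have := hC ζ ζ' s t
    rwa [mem_forestsOfSize.1 hζ, mem_forestsOfSize.1 hζ'] at this

end IsBranchedRoughPath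

/-! ### Distributions given by continuous functions -/

namespace IsContinuousFunction

open MeasureTheory

theorem unique {ξ η : Tempered} {f : ℝ → ℝ} (hξ : IsContinuousFunction ξ f)
    (hη : IsContinuousFunction η f) : ξ = η := by
  ext u
  rw [(hξ.2 u).2, (hη.2 u).2]

theorem add {ξ η : Tempered} {f g : ℝ → ℝ} (hξ : IsContinuousFunction ξ f)
    (hη : IsContinuousFunction η g) : IsContinuousFunction (ξ + η) fun t => f t + g t := by
  refine ⟨hξ.1.add hη.1, fun u => ?_⟩
  simp only [add_mul]
  refine ⟨(hξ.2 u).1.add (hη.2 u).1, ?_⟩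
  rw [integral_add (hξ.2 u).1 (hη.2 u).1, ← (hξ.2 u).2, ← (hη.2 u).2]
  rfl

theorem smul {ξ : Tempered} {f : ℝ → ℝ} (hξ : IsContinuousFunction ξ f) (c : ℝ) :
    IsContinuousFunction (c • ξ) fun t => c * f t := by
  refine ⟨continuous_const.mul hξ.1, fun u => ?_⟩
  simp only [mul_assoc]
  refine ⟨(hξ.2 u).1.const_mul c, ?_⟩
  rw [integral_const_mul, ← (hξ.2 u).2]
  rfl

/-- The distribution is the duality pairing of `L^∞` with `L^1`, composed with the continuous
embedding of Schwartz functions into `L^1`. -/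
theorem exists_of_bounded {f : ℝ → ℝ} (hf : Continuous f) {C : ℝ} (hC : ∀ t, |f t| ≤ C) :
    ∃ ξ : Tempered, IsContinuousFunction ξ f := by
  have hm : MemLp f ⊤ volume :=
    memLp_top_of_bound hf.aestronglyMeasurable C (Filter.Eventually.of_forall hC)
  refine ⟨(ContinuousLinearMap.lsmul ℝ ℝ).lpPairing volume ⊤ 1 (hm.toLp f) ∘L
    SchwartzMap.toLpCLM ℝ ℝ 1 volume, hf, fun u => ⟨?_, ?_⟩⟩
  · exact u.integrable.bdd_mul hf.aestronglyMeasurable (Filter.Eventually.of_forall hC)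
  · rw [ContinuousLinearMap.comp_apply, ContinuousLinearMap.lpPairing_eq_integral]
    refine integral_congr_ae ?_
    filter_upwards [hm.coeFn_toLp, u.coeFn_toLp 1 volume] with t h1 h2
    change (hm.toLp f) t * (u.toLp 1 volume) t = _
    rw [h1, h2]

/-- The rescaled test function is at most `δ⁻¹` and lives on an interval of length `2δ`, on which
`|f| ≤ C δ^α`. -/
theorem abs_rescale_le {ξ : Tempered} {f : ℝ → ℝ} (hξ : IsContinuousFunction ξ f) {s C α : ℝ}
    (hC : 0 ≤ C) (hα : 0 ≤ α) (hf : ∀ t, |f t| ≤ C * |t - s| ^ α) {δ : ℝ} (hδ : 0 < δ)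
    {u : 𝓢(ℝ, ℝ)} (hu : u ∈ testFunctions) :
    |ξ (rescale s δ hδ.ne' u)| ≤ 2 * C * δ ^ α := by
  rw [(hξ.2 _).2, ← setIntegral_eq_integral_of_forall_compl_eq_zero (s := Set.Icc (s - δ) (s + δ))]
  · have := norm_setIntegral_le_of_norm_le_const (μ := volume) (s := Set.Icc (s - δ) (s + δ))
      (f := fun t => f t * rescale s δ hδ.ne' u t) (C := C * δ ^ α * δ⁻¹)
      (by simp) (fun t ht => by
        have hts : |t - s| ≤ δ := abs_le.2 ⟨by linarith [ht.1], by linarith [ht.2]⟩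
        rw [norm_mul, rescale_apply, norm_mul, Real.norm_of_nonneg (inv_pos.2 hδ).le]
        refine mul_le_mul ((hf t).trans ?_) ?_ (by positivity) (by positivity)
        · gcongr
        · exact mul_le_of_le_one_right (by positivity) (hu.2 _).1)
    refine this.trans_eq ?_
    rw [Real.volume_real_Icc_of_le (by linarith)]
    field_simp
    ring
  · intro t ht
    rw [rescale_apply, image_eq_zero_of_notMem_tsupport (f := u), mul_zero, mul_zero]
    intro h
    have := hu.1 h
    rw [Metric.mem_ball, dist_zero_right, norm_mul, norm_inv, Real.norm_of_nonneg hδ.le,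
      inv_mul_lt_one₀ hδ, Real.norm_eq_abs, abs_lt] at this
    exact ht ⟨by linarith, by linarith⟩

end IsContinuousFunction

/-! ### The model of a branched rough path -/

namespace IsBranchedRoughPath

variable {γ T : ℝ} {X : Set.Icc (0 : ℝ) T → Set.Icc (0 : ℝ) T → Module.Dual ℝ (ForestSpace d)}

theorem exists_tempered (hX : IsBranchedRoughPath γ T X) (hγ : 0 < γ) (hT : 0 ≤ T)
    (s : Set.Icc (0 : ℝ) T) (x : ForestSpace d) :
    ∃ ξ : Tempered, IsContinuousFunction ξ fun t => X s (Set.projIcc 0 T hT t) x := by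
  obtain ⟨C, hC⟩ := hX.exists_bound hγ hT x
  exact IsContinuousFunction.exists_of_bounded (hX.continuous_right hγ hT s x) fun t => hC _ _

/-- The distributions `x ↦ X_{s·}(x)`, extended by constants outside `[0,T]`. -/
noncomputable def modelMap (hX : IsBranchedRoughPath γ T X) (hγ : 0 < γ) (hT : 0 ≤ T)
    (s : Set.Icc (0 : ℝ) T) : ForestSpace d →ₗ[ℝ] Tempered where
  toFun x := (hX.exists_tempered hγ hT s x).choose
  map_add' x y := (hX.exists_tempered hγ hT s (x + y)).choose_spec.unique <| by
    simpa only [map_add] using (hX.exists_tempered hγ hT s x).choose_spec.add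
      (hX.exists_tempered hγ hT s y).choose_spec
  map_smul' c x := (hX.exists_tempered hγ hT s (c • x)).choose_spec.unique <| by
    simpa only [map_smul, smul_eq_mul, RingHom.id_apply] using
      (hX.exists_tempered hγ hT s x).choose_spec.smul c

theorem isContinuousFunction_modelMap (hX : IsBranchedRoughPath γ T X) (hγ : 0 < γ) (hT : 0 ≤ T)
    (s : Set.Icc (0 : ℝ) T) (x : ForestSpace d) :
    IsContinuousFunction (hX.modelMap hγ hT s x) fun t => X s (Set.projIcc 0 T hT t) x :=
  (hX.exists_tempered hγ hT s x).choose_spec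

/-- The model that corresponds to a branched rough path. -/
noncomputable def model (hX : IsBranchedRoughPath γ T X) (hγ : 0 < γ) (hT : 0 ≤ T) :
    (ℝ → ForestSpace d →ₗ[ℝ] Tempered) × (ℝ → ℝ → ForestSpace d →ₗ[ℝ] ForestSpace d) :=
  (fun s => hX.modelMap hγ hT (Set.projIcc 0 T hT s),
    fun s t => leftAction (X (Set.projIcc 0 T hT t) (Set.projIcc 0 T hT s)))

theorem isModel (hX : IsBranchedRoughPath γ T X) (hγ : 0 < γ) (hT : 0 ≤ T) :
    IsModel γ (hX.model hγ hT).1 (hX.model hγ hT).2 where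
  bimap := hX.isBimap hγ hT
  comp s t := LinearMap.ext fun x => by
    -- By Chen's relation both distributions are given by the same continuous function.
    refine IsContinuousFunction.unique ?_ (hX.isContinuousFunction_modelMap hγ hT _ x)
    have := hX.isContinuousFunction_modelMap hγ hT (Set.projIcc 0 T hT s)
      (leftAction (X (Set.projIcc 0 T hT t) (Set.projIcc 0 T hT s)) x)
    simp only [hX.apply_leftAction] at this
    exact this
  bound K _ k := by
    choose C hC0 hC using hX.exists_holder hγ hT
    refine ⟨∑ ζ ∈ forestsOfSize d k, 2 * C ζ, fun s _ δ hδ _ a ha u hu => ?_⟩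
    let ev : Tempered →ₗ[ℝ] ℝ :=
      { toFun := fun ξ => ξ (rescale s δ hδ.ne' u)
        map_add' := fun _ _ => rfl
        map_smul' := fun _ _ => rfl }
    refine (abs_le_of_mem_level ha (ev ∘ₗ (hX.model hγ hT).1 s)).trans ?_
    rw [mul_comm _ (forestNorm a), mul_assoc, Finset.sum_mul]
    refine mul_le_mul_of_nonneg_left (Finset.sum_le_sum fun ζ hζ => ?_) (forestNorm_nonneg a)
    rw [← mem_forestsOfSize.1 hζ]
    exact (hX.isContinuousFunction_modelMap hγ hT _ _).abs_rescale_le (hC0 ζ) (by positivity)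
      (hC ζ s) hδ hu

theorem model_mem_normalizedModels (hX : IsBranchedRoughPath γ T X) (hγ : 0 < γ) (hT : 0 ≤ T) :
    hX.model hγ hT ∈ normalizedModels d γ T := by
  refine ⟨hX.isModel hγ hT, fun s => ?_, fun s t hs ht => ?_, fun s t hs ht => ?_⟩
  · have := hX.isContinuousFunction_modelMap hγ hT (Set.projIcc 0 T hT s) 1
    simp only [hX.map_one] at this
    exact this
  · simp only [model]
    rw [Set.projIcc_of_le_left hT hs, Set.projIcc_of_le_left hT ht, hX.diag, leftAction_counit]
  · simp only [model]
    rw [Set.projIcc_of_right_le hT hs, Set.projIcc_of_right_le hT ht, hX.diag, leftAction_counit]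

theorem corresponds_model (hX : IsBranchedRoughPath γ T X) (hγ : 0 < γ) (hT : 0 ≤ T) :
    Corresponds X (hX.model hγ hT) := by
  refine ⟨fun s x => ⟨_, hX.isContinuousFunction_modelMap hγ hT _ x, fun t => ?_⟩, fun s t x => ?_⟩
  · rw [Set.projIcc_val, Set.projIcc_val]
  · simp only [model, Set.projIcc_val]

end IsBranchedRoughPath

/-! ### The character of a bimap -/

namespace IsBimap

variable {γ : ℝ} {Γ : ℝ → ℝ → ForestSpace d →ₗ[ℝ] ForestSpace d}

theorem exists_char (hΓ : IsBimap γ Γ) (s t : ℝ) : ∃ g : ForestSpace d →ₐ[ℝ] ℝ,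
    g.toLinearMap = counit ∘ₗ Γ s t ∧ Γ s t = leftAction g.toLinearMap := by
  obtain ⟨g, hg⟩ := hΓ.mem s t
  refine ⟨g, LinearMap.ext fun x => ?_, hg⟩
  rw [LinearMap.comp_apply, hg, counit_leftAction]
  rfl

theorem leftAction_counit_comp (hΓ : IsBimap γ Γ) (s t : ℝ) :
    leftAction (counit ∘ₗ Γ s t) = Γ s t := by
  obtain ⟨g, hg, h⟩ := hΓ.exists_char s t
  rw [← hg, ← h]

theorem counit_map_one (hΓ : IsBimap γ Γ) (s t : ℝ) : counit (Γ s t 1) = 1 := by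
  obtain ⟨g, hg, -⟩ := hΓ.exists_char s t
  rw [← LinearMap.comp_apply, ← hg]
  exact map_one g

/-- The counit is the component at level `0`, so this is the bimap bound at `m = 0`. That bound
requires `m < |ζ|`, so the empty forest is treated through `Γ 1`. -/
theorem exists_counit_le (hΓ : IsBimap γ Γ) {K : Set ℝ} (hK : IsCompact K)
    (ζ : Forest (Fin d)) : ∃ C, 0 ≤ C ∧ ∀ s ∈ K, ∀ t ∈ K,
      |counit (Γ s t (basisForest ζ))| ≤ C * |s - t| ^ (γ * (ζ.size : ℝ)) := by
  by_cases hζ : ζ = 1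
  · subst hζ
    refine ⟨1, zero_le_one, fun s _ t _ => ?_⟩
    simp [basisForest_one, hΓ.counit_map_one]
  · obtain ⟨C, hC⟩ := hΓ.bound K hK ζ.size
    have hpos : 0 < ζ.size := Nat.pos_of_ne_zero fun h => hζ (Forest.size_eq_zero.1 h)
    refine ⟨|C * forestNorm (basisForest ζ)|, abs_nonneg _, fun s hs t ht => ?_⟩
    have h := hC s hs t ht _ (basisForest_mem_level ζ) 0 hpos
    rw [Nat.cast_zero, mul_zero, sub_zero] at h
    refine (abs_counit_le_levelNorm _).trans (h.trans ?_)
    exact mul_le_mul_of_nonneg_right (le_abs_self _) (by positivity)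

theorem exists_counit_bound (hΓ : IsBimap γ Γ) (hγ : 0 < γ) {K : Set ℝ} (hK : IsCompact K)
    (ζ : Forest (Fin d)) :
    ∃ C, 0 ≤ C ∧ ∀ s ∈ K, ∀ t ∈ K, |counit (Γ s t (basisForest ζ))| ≤ C := by
  obtain ⟨C, hC0, hC⟩ := hΓ.exists_counit_le hK ζ
  obtain ⟨D, hD⟩ := Metric.isBounded_iff.1 hK.isBounded
  refine ⟨C * |D| ^ (γ * (ζ.size : ℝ)), by positivity, fun s hs t ht => (hC s hs t ht).trans ?_⟩
  have : |s - t| ≤ |D| := (hD hs ht).trans (le_abs_self D)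
  gcongr

end IsBimap

/-! ### Uniqueness of the reconstruction -/

namespace IsModel

variable {γ : ℝ} {P P' : ℝ → ForestSpace d →ₗ[ℝ] Tempered}
  {Γ : ℝ → ℝ → ForestSpace d →ₗ[ℝ] ForestSpace d}

/-- A nonempty forest has homogeneity at least `γ`, and on the empty forest the two models agree. -/
theorem exists_sub_basisForest_le (h : IsModel γ P Γ) (h' : IsModel γ P' Γ) (hγ : 0 < γ)
    (h1 : ∀ s, P s 1 = P' s 1) {K : Set ℝ} (hK : IsCompact K) (ζ : Forest (Fin d)) :
    ∃ C, 0 ≤ C ∧ ∀ s ∈ K, ∀ δ : ℝ, ∀ hδ : 0 < δ, δ ≤ 1 → ∀ u ∈ testFunctions,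
      |(P s - P' s) (basisForest ζ) (rescale s δ hδ.ne' u)| ≤ C * δ ^ γ := by
  by_cases hζ : ζ = 1
  · subst hζ
    refine ⟨0, le_rfl, fun s _ δ hδ _ u _ => ?_⟩
    rw [LinearMap.sub_apply, basisForest_one, h1, sub_self]
    simp
  · obtain ⟨C, hC⟩ := h.bound K hK ζ.size
    obtain ⟨C', hC'⟩ := h'.bound K hK ζ.size
    refine ⟨|C * forestNorm (basisForest ζ)| + |C' * forestNorm (basisForest ζ)|, by positivity,
      fun s hs δ hδ hδ1 u hu => ?_⟩
    have e := hC s hs δ hδ hδ1 _ (basisForest_mem_level ζ) u hu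
    have e' := hC' s hs δ hδ hδ1 _ (basisForest_mem_level ζ) u hu
    have hpow : δ ^ (γ * (ζ.size : ℝ)) ≤ δ ^ γ := by
      refine Real.rpow_le_rpow_of_exponent_ge hδ hδ1 (le_mul_of_one_le_right hγ.le ?_)
      exact_mod_cast Nat.one_le_iff_ne_zero.2 fun h => hζ (Forest.size_eq_zero.1 h)
    rw [LinearMap.sub_apply, sub_apply, add_mul]
    refine (abs_sub _ _).trans (add_le_add (e.trans ?_) (e'.trans ?_)) <;>
      exact mul_le_mul (le_abs_self _) hpow (by positivity) (abs_nonneg _)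

/-- The distribution based at `t` is tested near other points `s`. Since both models share `Γ`, it
equals `(Π_s - Π'_s) Γ_{st} ζ`, a finite combination of forests recentred at `s` with coefficients
bounded for `s ∈ K`. -/
theorem exists_sub_le (h : IsModel γ P Γ) (h' : IsModel γ P' Γ) (hγ : 0 < γ)
    (h1 : ∀ s, P s 1 = P' s 1) (t : ℝ) (ζ : Forest (Fin d)) {K : Set ℝ} (hK : IsCompact K) :
    ∃ C, ∀ s ∈ K, ∀ δ : ℝ, ∀ hδ : 0 < δ, δ ≤ 1 → ∀ u ∈ testFunctions,
      |(P t - P' t) (basisForest ζ) (rescale s δ hδ.ne' u)| ≤ C * δ ^ γ := by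
  have e : ∀ s, (P t - P' t) (basisForest ζ) =
      (P s - P' s) (leftAction (counit ∘ₗ Γ s t) (basisForest ζ)) := fun s => by
    rw [h.bimap.leftAction_counit_comp, LinearMap.sub_apply, LinearMap.sub_apply,
      ← LinearMap.comp_apply, ← LinearMap.comp_apply, h.comp, h'.comp]
  obtain ⟨l, -, hl⟩ := exists_coproduct_eq ζ
  suffices ∃ C, ∀ s ∈ K, ∀ δ : ℝ, ∀ hδ : 0 < δ, δ ≤ 1 → ∀ u ∈ testFunctions,
      |(P s - P' s) (l.map fun p => (counit ∘ₗ Γ s t) (basisForest p.1) • basisForest p.2).sum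
        (rescale s δ hδ.ne' u)| ≤ C * δ ^ γ by
    obtain ⟨C, hC⟩ := this
    exact ⟨C, fun s hs => by rw [e s, leftAction_eq_sum hl]; exact hC s hs⟩
  clear hl
  induction l with
  | nil => exact ⟨0, fun s _ δ _ _ u _ => by simp⟩
  | cons p l ih =>
    obtain ⟨C, hC⟩ := ih
    -- The base point `t` need not lie in `K`.
    obtain ⟨A, hA0, hA⟩ := h.bimap.exists_counit_bound hγ (hK.insert t) p.1
    obtain ⟨B, hB0, hB⟩ := h.exists_sub_basisForest_le h' hγ h1 hK p.2
    refine ⟨A * B + C, fun s hs δ hδ hδ1 u hu => ?_⟩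
    rw [List.map_cons, List.sum_cons, map_add, add_apply, add_mul, map_smul]
    refine (abs_add_le _ _).trans (add_le_add ?_ (hC s hs δ hδ hδ1 u hu))
    rw [smul_apply, smul_eq_mul, abs_mul, mul_assoc]
    exact mul_le_mul (hA s (Set.mem_insert_of_mem _ hs) t (Set.mem_insert _ _))
      (hB s hs δ hδ hδ1 u hu) (abs_nonneg _) hA0

theorem eq_of_map_one_eq (h : IsModel γ P Γ) (h' : IsModel γ P' Γ) (hγ : 0 < γ)
    (h1 : ∀ s, P s 1 = P' s 1) : P = P' :=
  funext fun t => linearMap_ext fun ζ => sub_eq_zero.1 <|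
    Tempered.eq_zero_of_rescale_le hγ fun _ hK => h.exists_sub_le h' hγ h1 t ζ hK

end IsModel

/-! ### Normalized models -/

variable {γ T : ℝ} {M N : (ℝ → ForestSpace d →ₗ[ℝ] Tempered) ×
  (ℝ → ℝ → ForestSpace d →ₗ[ℝ] ForestSpace d)}

/-- In `Γ_{st} = Γ_{s,p(s)} Γ_{p(s),p(t)} Γ_{p(t),t}`, with `p` the projection onto `[0,T]`, the
outer factors are the identity. -/
theorem map_projIcc_of_mem_normalizedModels (hM : M ∈ normalizedModels d γ T) (hT : 0 ≤ T)
    (s t : ℝ) : M.2 s t = M.2 (Set.projIcc 0 T hT s) (Set.projIcc 0 T hT t) := by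
  obtain ⟨hmod, -, hl, hr⟩ := hM
  have key : ∀ s : ℝ, M.2 s (Set.projIcc 0 T hT s) = LinearMap.id ∧
      M.2 (Set.projIcc 0 T hT s) s = LinearMap.id := by
    intro s
    rcases le_or_gt s 0 with h0 | h0
    · rw [Set.projIcc_of_le_left hT h0]
      exact ⟨hl _ _ h0 le_rfl, hl _ _ le_rfl h0⟩
    · rcases le_or_gt T s with h1 | h1
      · rw [Set.projIcc_of_right_le hT h1]
        exact ⟨hr _ _ h1 le_rfl, hr _ _ le_rfl h1⟩
      · rw [Set.projIcc_of_mem hT ⟨h0.le, h1.le⟩]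
        exact ⟨hmod.bimap.diag s, hmod.bimap.diag s⟩
  rw [← hmod.bimap.comp s (Set.projIcc 0 T hT s) t,
    ← hmod.bimap.comp (Set.projIcc 0 T hT s) (Set.projIcc 0 T hT t) t, (key s).1, (key t).2]
  rfl

theorem eq_of_mem_normalizedModels (hγ : 0 < γ) (hT : 0 ≤ T) (hM : M ∈ normalizedModels d γ T)
    (hN : N ∈ normalizedModels d γ T)
    (h : ∀ s t : Set.Icc (0 : ℝ) T, M.2 s t = N.2 s t) : M = N := by
  have h2 : M.2 = N.2 := funext fun s => funext fun t => by
    rw [map_projIcc_of_mem_normalizedModels hM hT, map_projIcc_of_mem_normalizedModels hN hT, h]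
  refine Prod.ext (IsModel.eq_of_map_one_eq hM.1 (h2 ▸ hN.1) hγ fun s => ?_) h2
  exact (hM.2.1 s).unique (hN.2.1 s)

/-- The swapped time arguments match the reversal of order in `leftAction_comp`: the convolution of
`X_{su}` and `X_{ut}` is `ε ∘ Γ_{tu} ∘ Γ_{us} = ε ∘ Γ_{ts}`. -/
theorem isBranchedRoughPath_of_mem_normalizedModels (hM : M ∈ normalizedModels d γ T) :
    IsBranchedRoughPath γ T fun s t : Set.Icc (0 : ℝ) T => counit ∘ₗ M.2 t s := by
  have hΓ := hM.1.bimap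
  refine ⟨fun s t => hΓ.counit_map_one _ _, fun s t a b => ?_, fun t => ?_, fun s u t ζ => ?_,
    fun ζ => ?_⟩
  · obtain ⟨g, hg, -⟩ := hΓ.exists_char t s
    simp only [← hg, AlgHom.toLinearMap_apply, map_mul]
  · simp only [hΓ.diag, LinearMap.comp_id]
  · rw [convolution_apply, hΓ.leftAction_counit_comp, ← hΓ.comp t u s]
    rfl
  · obtain ⟨C, -, hC⟩ := hΓ.exists_counit_le (isCompact_Icc (a := (0 : ℝ)) (b := T)) ζ
    refine ⟨C, fun s t hst => ?_⟩
    have hpos : 0 < |(t : ℝ) - s| := by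
      rw [abs_pos, sub_ne_zero]
      exact fun e => hst (Subtype.ext e.symm)
    rw [div_le_iff₀ (by positivity)]
    exact hC t t.2 s s.2

end ConnesKreimer

/-! ### The bijection between branched rough paths and normalized models -/

open ConnesKreimer
theorem mainTheorem6 (d : ℕ) (γ T : ℝ) (hγ₀ : 0 < γ) (hγ₁ : γ < 1) (hT : 0 < T) :
    ∃ I : branchedRoughPaths d γ T → normalizedModels d γ T,
      Function.Bijective I ∧
      ∀ X : branchedRoughPaths d γ T,
        Corresponds X.1 (I X).1 ∧
        ∀ M : normalizedModels d γ T, Corresponds X.1 M.1 → M = I X := by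
  let I : branchedRoughPaths d γ T → normalizedModels d γ T := fun X =>
    ⟨X.2.model hγ₀ hT.le, X.2.model_mem_normalizedModels hγ₀ hT.le⟩
  have hI : ∀ X, Corresponds X.1 (I X).1 := fun X => X.2.corresponds_model hγ₀ hT.le
  refine ⟨I, ⟨fun X X' h => Subtype.ext ?_, fun M => ?_⟩, fun X => ⟨hI X, fun M hM => ?_⟩⟩
  -- Injectivity: `X_{st} = ε ∘ Γ_{ts}` recovers the rough path.
  · funext s t
    refine LinearMap.ext fun x => ?_
    have h1 := (hI X).2 t s x
    have h2 := (hI X').2 t s x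
    rw [← X.2.counit_leftAction, ← X'.2.counit_leftAction, ← h1, ← h2, h]
  -- Surjectivity: the model built from `ε ∘ Γ_{ts}` has the same `Γ` on `[0,T]` as `M`, hence
  -- equals `M`.
  · refine ⟨⟨_, isBranchedRoughPath_of_mem_normalizedModels M.2⟩, Subtype.ext ?_⟩
    refine eq_of_mem_normalizedModels hγ₀ hT.le (I _).2 M.2 fun s t => ?_
    refine (LinearMap.ext ((hI _).2 s t)).trans ?_
    exact M.2.1.bimap.leftAction_counit_comp s t
  -- Uniqueness follows from the condition on `Γ` alone.
  · refine Subtype.ext (eq_of_mem_normalizedModels hγ₀ hT.le M.2 (I X).2 fun s t => ?_)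
    exact LinearMap.ext fun x => (hM.2 s t x).trans ((hI X).2 s t x).symm
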